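/- **Conventions.** $\lambda$ is the security parameter and $\mathsf{negl}$ stands for a negligible function. A QPT algorithm is a family of quantum circuits (one for each $\lambda$, over the gate set $X,H,T,T^\dagger$, CNOT, Toffoli, with ancillas initialised to $|0\rangle$, some output qubits, and the remaining qubits traced out) whose descriptions are computed from $1^\lambda$ by a deterministic polynomial-time Turing machine. Let $\kappa=\kappa(\lambda)$ and $m=m(\lambda)$. A *one-way state generator* (OWSG) is a triple of QPT algorithms $(\mathsf{KeyGen},\mathsf{StateGen},\mathsf{Ver})$, where $\mathsf{KeyGen}(1^\lambda)$ outputs a classical key $k\in\{0,1\}^\kappa$, $\mathsf{StateGen}(k)$ outputs an $m$-qubit (possibly mixed) state $\phi_k$, and $\mathsf{Ver}(k',\phi)$ outputs $\top$ or $\bot$ on input $k'\in\{0,1\}^\kappa$ and an $m$-qubit state $\phi$, such that * (correctness) $\Pr[\top\gets\mathsf{Ver}(k,\phi_k): k\gets\mathsf{KeyGen}(1^\lambda),\ \phi_k\gets\mathsf{StateGen}(k)]\ge 1-\mathsf{negl}(\lambda)$; * (security) for every polynomial $t$ and every QPT adversary $\mathcal A$, $$\Pr[\top\gets\mathsf{Ver}(k',\phi_k):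 k\gets\mathsf{KeyGen}(1^\lambda),\ \phi_k\gets\mathsf{StateGen}(k),\ k'\gets\mathcal A(\phi_k^{\otimes t(\lambda)})]\le\mathsf{negl}(\lambda).$$ **Lemma.** Let $(\mathsf{KeyGen},\mathsf{StateGen},\mathsf{Ver})$ be an OWSG such that * for every $\lambda$ and every $k\in\{0,1\}^\kappa$ the state $\phi_k$ is pure, $\phi_k=|\phi_k\rangle\langle\phi_k|$; * there is a negligible function $\nu$ such that $\Pr[\top\gets\mathsf{Ver}(k,\phi_k)]\ge 1-\nu(\lambda)$ for all $\lambda$ and all $k\in\{0,1\}^\kappa$. Then there is a QPT algorithm $\mathsf{Ver}'$ that performs the projective measurement onto $|\phi_{k'}\rangle$: on input $k'$ and an arbitrary $m$-qubit state $\rho$, it outputs $\top$ with probability exactly $\langle\phi_{k'}|\rho|\phi_{k'}\rangle$, the probability of the first outcome of $\{|\phi_{k'}\rangle\langle\phi_{k'}|,\ I-|\phi_{k'}\rangle\langle\phi_{k'}|\}$, and $\bot$ otherwise. Moreover, $(\mathsf{KeyGen},\mathsf{StateGen},\mathsf{Ver}')$ is an OWSG. In particular, if $\mathsf{KeyGen}(1^\lambda)$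 is uniformly distributed on $\{0,1\}^\kappa$ for every $\lambda$, then $\mathsf{StateGen}$ is an OWSG in the original sense of Morimae and Yamakawa: it is a QPT algorithm with pure outputs $|\phi_k\rangle$, and for every polynomial $t$ and every QPT adversary $\mathcal A$, $$\sum_{k,k'\in\{0,1\}^\kappa}2^{-\kappa}\,\Pr[k'\gets\mathcal A(|\phi_k\rangle^{\otimes t(\lambda)})]\,|\langle\phi_k|\phi_{k'}\rangle|^2\le\mathsf{negl}(\lambda).$$ -/

import Mathlib

noncomputable section

namespace QCrypto

open Filter
open scoped ComplexOrder

/-! ### Quantum circuits -/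

/-- Bit strings of length `n`; they index the computational basis of `n` qubits. -/
abbrev Bits (n : ℕ) : Type := Fin n → Bool

/-- Operators on `n` qubits, as matrices in the computational basis. -/
abbrev Op (n : ℕ) : Type := Matrix (Bits n) (Bits n) ℂ

/-- The elementary gates on `w` qubits: Clifford+T, with the Toffoli gate. -/
inductive Gate (w : ℕ) : Type
  | x (a : Fin w)
  | h (a : Fin w)
  | t (a : Fin w)
  | tdg (a : Fin w)
  | cnot (c a : Fin w) (hne : c ≠ a)
  | tof (c d a : Fin w) (hcd : c ≠ d) (hca : c ≠ a) (hda : d ≠ a)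

/-- The one-qubit operator `u` acting on qubit `a` (and trivially on the other qubits). -/
def onQubit {w : ℕ} (a : Fin w) (u : Bool → Bool → ℂ) : Op w :=
  fun x y => if ∀ j, j ≠ a → x j = y j then u (x a) (y a) else 0

/-- The operator `|y⟩ ↦ |f y⟩`. -/
def basisMap {w : ℕ} (f : Bits w → Bits w) : Op w :=
  fun x y => if x = f y then 1 else 0

/-- The unitary matrix of a gate. -/
def Gate.mat {w : ℕ} : Gate w → Op w
  | .x a => basisMap fun y => Function.update y a (!(y a))
  | .h a => onQubit a fun i j => (if i && j then -1 else 1) / (Real.sqrt 2 : ℂ)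
  | .t a => onQubit a fun i j =>
      if i = j then (if i then Complex.exp (Complex.I * (Real.pi / 4)) else 1) else 0
  | .tdg a => onQubit a fun i j =>
      if i = j then (if i then Complex.exp (-(Complex.I * (Real.pi / 4))) else 1) else 0
  | .cnot c a _ => basisMap fun y => Function.update y a (xor (y a) (y c))
  | .tof c d a _ _ _ => basisMap fun y => Function.update y a (xor (y a) (y c && y d))

/-- A quantum circuit with `nin` input qubits and `nout` output qubits. It acts on `width` qubits.
The input is placed on the first `nin` qubits, the others start in `|0⟩`; the gates are applied from
left to right; the output is the state of the first `nout` qubits, the others are discarded. -/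
structure QCircuit (nin nout : ℕ) : Type where
  width : ℕ
  nin_le : nin ≤ width
  nout_le : nout ≤ width
  gates : List (Gate width)

/-- The unitary matrix of the gate sequence of a circuit. -/
def QCircuit.unitary {a b : ℕ} (C : QCircuit a b) : Op C.width :=
  C.gates.foldl (fun U g => g.mat * U) 1

/-- `ρ ⊗ |0…0⟩⟨0…0|` on `w` qubits, for an operator `ρ` on the first `a` of them. -/
def padZero {a w : ℕ} (h : a ≤ w) (ρ : Op a) : Op w :=
  fun x y =>
    if (∀ j : Fin w, a ≤ j.val → x j = false) ∧ (∀ j : Fin w, a ≤ j.val → y j = false) then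
      ρ (fun i => x (Fin.castLE h i)) (fun i => y (Fin.castLE h i))
    else 0

/-- The partial trace of an operator on `w` qubits over all but the first `b` qubits. -/
def traceRest {b w : ℕ} (h : b ≤ w) (M : Op w) : Op b :=
  fun u v => ∑ x : Bits w, ∑ y : Bits w,
    if (∀ i, x (Fin.castLE h i) = u i) ∧ (∀ i, y (Fin.castLE h i) = v i) ∧
        (∀ j : Fin w, b ≤ j.val → x j = y j) then M x y
    else 0

/-- The output (density operator) of a circuit on a given input (density operator). -/
def QCircuit.run {a b : ℕ} (C : QCircuit a b) (ρ : Op a) : Op b :=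
  traceRest C.nout_le (C.unitary * padZero C.nin_le ρ * C.unitary.conjTranspose)

/-! ### States and measurements -/

/-- Density operators. -/
def IsState {n : ℕ} (ρ : Op n) : Prop := ρ.PosSemidef ∧ ρ.trace = 1

/-- `|ψ⟩⟨ψ|`. -/
def pureOp {n : ℕ} (ψ : Bits n → ℂ) : Op n := Matrix.vecMulVec ψ (star ψ)

/-- The inner product `⟨ψ|χ⟩`. -/
def braket {n : ℕ} (ψ χ : Bits n → ℂ) : ℂ := star ψ ⬝ᵥ χ

/-- `ρ` is the density operator of the pure state given by the unit vector `ψ`. -/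
def IsPureStateOf {n : ℕ} (ρ : Op n) (ψ : Bits n → ℂ) : Prop :=
  braket ψ ψ = 1 ∧ ρ = pureOp ψ

/-- The density operator `|x⟩⟨x|` of the classical string `x`. -/
def classical {n : ℕ} (x : Bits n) : Op n := Matrix.single x x 1

/-- `ρ ⊗ σ`. -/
def tensor {a b : ℕ} (ρ : Op a) (σ : Op b) : Op (a + b) :=
  fun x y =>
    ρ (fun i => x (Fin.castAdd b i)) (fun i => y (Fin.castAdd b i)) *
      σ (fun i => x (Fin.natAdd a i)) (fun i => y (Fin.natAdd a i))

/-- `ρ ⊗ ⋯ ⊗ ρ` with `t` factors. -/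
def copies {n : ℕ} (t : ℕ) (ρ : Op n) : Op (t * n) :=
  fun x y => ∏ i : Fin t,
    ρ (fun j => x (finProdFinEquiv (i, j))) (fun j => y (finProdFinEquiv (i, j)))

/-- The probability of outcome `x` when `ρ` is measured in the computational basis. -/
def outcomeProb {n : ℕ} (ρ : Op n) (x : Bits n) : ℝ := (ρ x x).re

/-! ### Quantum polynomial time -/

/-- The alphabet in which circuits are written down. -/
inductive Symb : Type
  | one | sep | x | h | t | tdg | cnot | tof
  deriving DecidableEq

/-- A natural number in unary, followed by a separator. -/
def encNat (n : ℕ) : List Symb := List.replicate n Symb.one ++ [Symb.sep]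

/-- The description of a gate. -/
def Gate.encode {w : ℕ} : Gate w → List Symb
  | .x a => Symb.x :: encNat a
  | .h a => Symb.h :: encNat a
  | .t a => Symb.t :: encNat a
  | .tdg a => Symb.tdg :: encNat a
  | .cnot c a _ => Symb.cnot :: (encNat c ++ encNat a)
  | .tof c d a _ _ _ => Symb.tof :: (encNat c ++ encNat d ++ encNat a)

/-- The description of a circuit: number of input qubits, number of output qubits, width, gates. -/
def QCircuit.encode {a b : ℕ} (C : QCircuit a b) : List Symb :=
  encNat a ++ encNat b ++ encNat C.width ++ C.gates.flatMap Gate.encode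

/-- A QPT algorithm, as a uniform family of quantum circuits, one for each value `n` of the security
parameter: some deterministic polynomial-time Turing machine outputs, on input `1ⁿ`, the description
of the `n`-th circuit. -/
def IsQPT {a b : ℕ → ℕ} (C : ∀ n, QCircuit (a n) (b n)) : Prop :=
  Nonempty (Turing.TM2ComputableInPolyTime Computability.unaryEncodeNat
    (id : List Symb → List Symb) (fun n => (C n).encode))

/-- Negligible functions of the security parameter. -/
def Negligible (ν : ℕ → ℝ) : Prop :=
  Asymptotics.SuperpolynomialDecay atTop (fun n : ℕ => (n : ℝ)) ν

/-! ### One-way state generators -/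

section Schemes

variable {κ m : ℕ → ℕ}

/-- `Pr[k ← KeyGen(1ⁿ)]`. The circuit `KeyGen n` has no input qubits: its input is the only state of
zero qubits, and its output is measured. -/
def keyProb (KeyGen : ∀ n, QCircuit 0 (κ n)) (n : ℕ) (k : Bits (κ n)) : ℝ :=
  outcomeProb ((KeyGen n).run 1) k

/-- The state `φ_k ← StateGen(k)`. -/
def genState (StateGen : ∀ n, QCircuit (κ n) (m n)) (n : ℕ) (k : Bits (κ n)) : Op (m n) :=
  (StateGen n).run (classical k)

/-- `Pr[⊤ ← Ver(k', ρ)]`. The output of `Ver` is one measured qubit, `1` standing for `⊤`. -/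
def verProb (Ver : ∀ n, QCircuit (κ n + m n) 1) (n : ℕ) (k' : Bits (κ n)) (ρ : Op (m n)) : ℝ :=
  outcomeProb ((Ver n).run (tensor (classical k') ρ)) (fun _ => true)

/-- `Pr[k' ← A(φ_k^{⊗t(n)})]`. -/
def guessProb (StateGen : ∀ n, QCircuit (κ n) (m n)) (t : Polynomial ℕ)
    (A : ∀ n, QCircuit (t.eval n * m n) (κ n)) (n : ℕ) (k k' : Bits (κ n)) : ℝ :=
  outcomeProb ((A n).run (copies (t.eval n) (genState StateGen n k))) k'

/-- One-way state generators (with possibly mixed output states): the key has `κ n` bits and the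
state has `m n` qubits, where `n` is the security parameter. -/
structure IsOWSG (KeyGen : ∀ n, QCircuit 0 (κ n)) (StateGen : ∀ n, QCircuit (κ n) (m n))
    (Ver : ∀ n, QCircuit (κ n + m n) 1) : Prop where
  keyGen_qpt : IsQPT KeyGen
  stateGen_qpt : IsQPT StateGen
  ver_qpt : IsQPT Ver
  correct : ∃ ν, Negligible ν ∧ ∀ n,
    1 - ν n ≤ ∑ k, keyProb KeyGen n k * verProb Ver n k (genState StateGen n k)
  secure : ∀ (t : Polynomial ℕ) (A : ∀ n, QCircuit (t.eval n * m n) (κ n)), IsQPT A →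
    ∃ ν, Negligible ν ∧ ∀ n,
      ∑ k, ∑ k', keyProb KeyGen n k * guessProb StateGen t A n k k' *
        verProb Ver n k' (genState StateGen n k) ≤ ν n

/-- `Ver'` is the verification by projection: `Ver'(k', ρ)` accepts an arbitrary state `ρ` with the
probability of the first outcome when `ρ` is measured with
`{|φ_{k'}⟩⟨φ_{k'}|, I - |φ_{k'}⟩⟨φ_{k'}|}`, that is, with probability `⟨φ_{k'}|ρ|φ_{k'}⟩`. -/
def IsProjectionVer (StateGen : ∀ n, QCircuit (κ n) (m n))
    (Ver' : ∀ n, QCircuit (κ n + m n) 1) : Prop :=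
  ∀ (n : ℕ) (k' : Bits (κ n)) (ψ : Bits (m n) → ℂ),
    IsPureStateOf (genState StateGen n k') ψ →
      ∀ ρ : Op (m n), IsState ρ → (verProb Ver' n k' ρ : ℂ) = braket ψ (ρ.mulVec ψ)

/-- One-way state generators in the original sense: the outputs are pure states `|φ_k⟩`, the key is
uniformly random, and the alleged key `k'` is accepted with probability `|⟨φ_k|φ_{k'}⟩|²`. -/
def IsPureOWSG (StateGen : ∀ n, QCircuit (κ n) (m n)) : Prop :=
  IsQPT StateGen ∧
  ∃ φ : ∀ n, Bits (κ n) → Bits (m n) → ℂ,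
    (∀ n k, IsPureStateOf (genState StateGen n k) (φ n k)) ∧
    ∀ (t : Polynomial ℕ) (A : ∀ n, QCircuit (t.eval n * m n) (κ n)), IsQPT A →
      ∃ ν, Negligible ν ∧ ∀ n,
        ∑ k, ∑ k', (1 / 2 ^ κ n : ℝ) * guessProb StateGen t A n k k' *
          ‖braket (φ n k) (φ n k')‖ ^ 2 ≤ ν n

end Schemes

end QCrypto

end

open QCrypto

/-! The projection onto a preparable pure state is measured by undoing the preparation. Let `U` be
the unitary of the circuit `C` that prepares the state. Given `k` and `ρ`, the circuit
`QCircuit.projVer` adds `k` to a block of zeros, applies `U` to the block, swaps the output wires of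
the block with the wires of `ρ`, applies the inverse of `U`, and accepts if the block again reads
`k` followed by zeros. Between the basis states `u` and `s` of the state wires the amplitude of
returning to `k` is a partial matrix element of `U† · SWAP · U`, and it equals the `(s, u)` entry of
the reduced state `φ_k` (`preTest_initBits`). So the acceptance probability is the real part of `tr
(φ_k ρ φ_k†)`, whatever the discarded qubits contain (`outcomeProb_projVer`). If `φ_k` is pure it is
a projector, and the value is exactly `⟨φ_k|ρ|φ_k⟩`. There is no approximation error because the
gate set is closed under inverses.

Security follows from that of the given verification. If a measurement accepts `ψ` with probability
at least `1 - ν`, split `⟨χ|ψ⟩` into its accepting and rejecting parts. By Cauchy–Schwarz the first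
has square at most the probability that `χ` is accepted, the second at most `ν`; hence `|⟨χ|ψ⟩|² ≤ 2
Pr[χ accepted] + 2ν` (`norm_braket_sq_le`). Averaging over keys and guesses bounds the adversary's
success against the projection by twice its success against the given verification plus `2ν`. With
uniform keys this is security in the original sense.

It remains to show uniformity. A program over finitely many stacks rewrites the description of `C`
into that of `C.projVer` in polynomial time (`runs_projProg`). Structured programs are compiled into
stack machine code (`Runs.reachesIn`) and attached to the machine that describes the state generator
(`nonempty_computableInPolyTime_comp`). -/

namespace StackMachine

open Turing StateTransition

/-! ### Running time of stack machines -/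

section Reach

variable {K : Type} [DecidableEq K] {Γ : K → Type} {Λ σ : Type}

/-- The machine `M` gets from the configuration `c` to `c'` in at most `t` steps. -/
def ReachesIn (M : Λ → TM2.Stmt Γ Λ σ) (c c' : TM2.Cfg Γ Λ σ) (t : ℕ) : Prop :=
  ∃ n ≤ t, (flip bind (TM2.step M))^[n] (some c) = some c'

theorem ReachesIn.trans {M : Λ → TM2.Stmt Γ Λ σ} {c c' c'' : TM2.Cfg Γ Λ σ} {t t' : ℕ}
    (h : ReachesIn M c c' t) (h' : ReachesIn M c' c'' t') : ReachesIn M c c'' (t + t') := by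
  obtain ⟨n, hn, h⟩ := h
  obtain ⟨n', hn', h'⟩ := h'
  exact ⟨n' + n, by omega, by rw [Function.iterate_add_apply, h, h']⟩

theorem ReachesIn.mono {M : Λ → TM2.Stmt Γ Λ σ} {c c' : TM2.Cfg Γ Λ σ} {t t' : ℕ}
    (h : ReachesIn M c c' t) (ht : t ≤ t') : ReachesIn M c c' t' := by
  obtain ⟨n, hn, h⟩ := h
  exact ⟨n, hn.trans ht, h⟩

theorem reachesIn_step {M : Λ → TM2.Stmt Γ Λ σ} {l : Λ} {v : σ} {S : ∀ k, List (Γ k)}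
    {c' : TM2.Cfg Γ Λ σ} (h : TM2.stepAux (M l) v S = c') : ReachesIn M ⟨some l, v, S⟩ c' 1 :=
  ⟨1, le_rfl, by simp [flip, h]⟩

/-- The largest number of symbols that a statement may push. -/
def pushBound : TM2.Stmt Γ Λ σ → ℕ
  | .push _ _ q => pushBound q + 1
  | .peek _ _ q => pushBound q
  | .pop _ _ q => pushBound q
  | .load _ q => pushBound q
  | .branch _ q q' => max (pushBound q) (pushBound q')
  | .goto _ => 0
  | .halt => 0

/-- Execution follows a single branch of the statement, and only the pushes on that branch can
lengthen a stack. -/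
theorem length_stepAux_le (k : K) (q : TM2.Stmt Γ Λ σ) (v : σ) (S : ∀ k, List (Γ k)) :
    ((TM2.stepAux q v S).stk k).length ≤ (S k).length + pushBound q := by
  induction q generalizing v S with
  | push k' f q ih =>
    refine (ih _ _).trans ?_
    by_cases h : k = k'
    · subst h; simp [pushBound]; omega
    · simp [pushBound, Function.update_of_ne h]
  | peek k' f q ih => exact ih _ _
  | pop k' f q ih =>
    refine (ih _ _).trans ?_
    by_cases h : k = k'
    · subst h; simp [pushBound]
    · simp [pushBound, Function.update_of_ne h]
  | load f q ih => exact ih _ _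
  | branch f q q' ih ih' =>
    simp only [TM2.stepAux, pushBound]
    cases f v
    · have := ih' v S; simp only [cond_false]; omega
    · have := ih v S; simp only [cond_true]; omega
  | goto f => simp [pushBound]
  | halt => simp [pushBound]

/-- There are finitely many labels, so `pushBound` has a maximum over the code. This makes the
output of a polynomial-time machine polynomially long, as is needed to bound the time of a program
run on that output. -/
theorem exists_length_le_of_iterate [Fintype Λ] (M : Λ → TM2.Stmt Γ Λ σ) (k : K) :
    ∃ P : ℕ, ∀ (n : ℕ) (c c' : TM2.Cfg Γ Λ σ),
      (flip bind (TM2.step M))^[n] (some c) = some c' →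
        (c'.stk k).length ≤ (c.stk k).length + P * n := by
  refine ⟨Finset.univ.sup fun l => pushBound (M l), fun n => ?_⟩
  induction n with
  | zero => rintro c c' h; simp at h; simp [h]
  | succ n ih =>
    rintro c c' h
    rw [Function.iterate_succ_apply'] at h
    obtain ⟨d, hd, hdc⟩ : ∃ d, (flip bind (TM2.step M))^[n] (some c) = some d ∧
        TM2.step M d = some c' := by
      cases hd : (flip bind (TM2.step M))^[n] (some c) with
      | none => rw [hd] at h; simp [flip] at h
      | some d => rw [hd] at h; exact ⟨d, rfl, h⟩
    have h₁ := ih c d hd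
    obtain ⟨l, v, S⟩ := d
    cases l with
    | none => simp at hdc
    | some l =>
      simp only [TM2.step, Option.some.injEq] at hdc
      have h₂ := length_stepAux_le k (M l) v S
      have h₃ : pushBound (M l) ≤ Finset.univ.sup fun l => pushBound (M l) :=
        Finset.le_sup (f := fun l => pushBound (M l)) (Finset.mem_univ l)
      rw [hdc] at h₂
      simp only at h₁
      rw [Nat.mul_succ]
      omega

end Reach

/-! ### Structured programs -/

/-- Programs over a family `K` of stacks with alphabet `Γ`. The program `loop k last body` pops
symbols `s` off the stack `k`, and runs `body s` after each of them, until the stack is empty or a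
symbol with `last s` has been popped. -/
inductive Prog (K Γ : Type) : Type
  | nop : Prog K Γ
  | push (k : K) (s : Γ) : Prog K Γ
  | seq (p q : Prog K Γ) : Prog K Γ
  | loop (k : K) (last : Γ → Bool) (body : Γ → Prog K Γ) : Prog K Γ

section Prog

variable {K Γ : Type}

/-- `Runs p S S' t`: the program `p` turns the stacks `S` into `S'` in time at most `t`. -/
inductive Runs [DecidableEq K] : Prog K Γ → (K → List Γ) → (K → List Γ) → ℕ → Prop
  | nop (S) : Runs .nop S S 1
  | push (k s S) : Runs (.push k s) S (Function.update S k (s :: S k)) 1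
  | seq {p q S S' S'' t t'} : Runs p S S' t → Runs q S' S'' t' → Runs (.seq p q) S S'' (t + t')
  | loop_nil {k last body S} : S k = [] → Runs (.loop k last body) S S 1
  | loop_last {k last body S s r} : S k = s :: r → last s = true →
      Runs (.loop k last body) S (Function.update S k r) 1
  | loop_step {k last body S S' S'' s r t t'} : S k = s :: r → last s = false →
      Runs (body s) (Function.update S k r) S' t → Runs (.loop k last body) S' S'' t' →
        Runs (.loop k last body) S S'' (t + t' + 1)
  | mono {p S S' t t'} : Runs p S S' t → t ≤ t' → Runs p S S' t'

/-- The labels of the machine code of a program. -/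
def Prog.Label : Prog K Γ → Type
  | .nop => Unit
  | .push _ _ => Unit
  | .seq p q => p.Label ⊕ q.Label
  | .loop _ _ body => Unit ⊕ Σ s, (body s).Label

/-- The label at which the execution of a program starts. -/
def Prog.entry : (p : Prog K Γ) → p.Label
  | .nop => ()
  | .push _ _ => ()
  | .seq p _ => Sum.inl p.entry
  | .loop _ _ _ => Sum.inl ()

theorem Prog.finite_label [Finite Γ] (p : Prog K Γ) : Finite p.Label := by
  induction p with
  | nop => exact inferInstanceAs (Finite Unit)
  | push => exact inferInstanceAs (Finite Unit)
  | seq p q hp hq => exact inferInstanceAs (Finite (_ ⊕ _))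
  | loop k last body ih => exact inferInstanceAs (Finite (Unit ⊕ Σ s, (body s).Label))

variable [DecidableEq K] {K₀ : Type} [DecidableEq K₀] {Γ₀ : K₀ → Type} {σ₀ Λ : Type}

/-- The alphabets of a machine that has the stacks of two machines. -/
abbrev JoinAlph (Γ₀ : K₀ → Type) (K Γ : Type) : K₀ ⊕ K → Type
  | .inl k => Γ₀ k
  | .inr _ => Γ

/-- The machine code of a program, for a machine that has other stacks and variables as well. The
labels of the program are embedded by `f`, and the program is left by a jump to `exit`. -/
def Prog.code : (p : Prog K Γ) → (p.Label → Λ) → Λ → p.Label →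
    TM2.Stmt (JoinAlph Γ₀ K Γ) Λ (σ₀ × Option Γ)
  | .nop, _, exit, _ => .goto fun _ => exit
  | .push k s, _, exit, _ => .push (Sum.inr k) (fun _ => s) (.goto fun _ => exit)
  | .seq p q, f, exit, l =>
    match l with
    | .inl l => p.code (fun l => f (.inl l)) (f (.inr q.entry)) l
    | .inr l => q.code (fun l => f (.inr l)) exit l
  | .loop k last body, f, exit, l =>
    match l with
    | .inl _ => .pop (Sum.inr k) (fun v s => (v.1, s)) (.goto fun v =>
        match v.2 with
        | none => exit
        | some s => if last s then exit else f (.inr ⟨s, (body s).entry⟩))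
    | .inr ⟨s, l⟩ => (body s).code (fun l => f (.inr ⟨s, l⟩)) (f (.inl ())) l

/-- The stacks of a machine that has the stacks of two machines. -/
def joinStk (S₀ : ∀ k, List (Γ₀ k)) (S : K → List Γ) :
    ∀ k, List (JoinAlph Γ₀ K Γ k)
  | .inl k => S₀ k
  | .inr k => S k

theorem update_joinStk_inr (S₀ : ∀ k, List (Γ₀ k)) (S : K → List Γ) (k : K) (l : List Γ) :
    Function.update (joinStk S₀ S) (Sum.inr k) l = joinStk S₀ (Function.update S k l) := by
  funext k'
  rcases k' with k' | k'
  · rw [Function.update_of_ne (by simp)]; rfl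
  · by_cases h : k' = k
    · subst h; simp [joinStk]
    · rw [Function.update_of_ne (by simpa using h)]; simp [joinStk, h]

theorem update_joinStk_inl (S₀ : ∀ k, List (Γ₀ k)) (S : K → List Γ) (k : K₀) (l : List (Γ₀ k)) :
    Function.update (joinStk S₀ S) (Sum.inl k) l = joinStk (Function.update S₀ k l) S := by
  funext k'
  rcases k' with k' | k'
  · by_cases h : k' = k
    · subst h; simp [joinStk]
    · rw [Function.update_of_ne (by simpa using h)]; simp [joinStk, h]
  · rw [Function.update_of_ne (by simp)]; rfl

/-- Correctness of the compiler, by induction on the derivation of `Runs`. The exit label is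
generalized because a subprogram leaves to the entry of its successor or to the head of the
enclosing loop. The final `o'` is left open: it is whatever symbol the last pop put into the
register. -/
theorem Runs.reachesIn {M : Λ → TM2.Stmt (JoinAlph Γ₀ K Γ) Λ (σ₀ × Option Γ)}
    {p : Prog K Γ} {S S' : K → List Γ} {t : ℕ} (h : Runs p S S' t)
    (f : p.Label → Λ) (exit : Λ) (hM : ∀ l, M (f l) = p.code f exit l) (v : σ₀) (o : Option Γ)
    (S₀ : ∀ k, List (Γ₀ k)) :
    ∃ o', ReachesIn M ⟨some (f p.entry), (v, o), joinStk S₀ S⟩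
      ⟨some exit, (v, o'), joinStk S₀ S'⟩ t := by
  induction h generalizing exit o with
  | nop S => exact ⟨o, reachesIn_step (by rw [hM]; rfl)⟩
  | push k s S =>
    refine ⟨o, reachesIn_step ?_⟩
    rw [hM]
    simp only [Prog.code, TM2.stepAux]
    rw [← update_joinStk_inr]
    rfl
  | @seq p q S S' S'' t t' _ _ ih ih' =>
    obtain ⟨o₁, h₁⟩ := ih (fun l => f (.inl l)) (f (.inr q.entry)) (fun l => hM (.inl l)) o
    obtain ⟨o₂, h₂⟩ := ih' (fun l => f (.inr l)) exit (fun l => hM (.inr l)) o₁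
    exact ⟨o₂, h₁.trans h₂⟩
  | @loop_nil k last body S hk =>
    refine ⟨none, reachesIn_step ?_⟩
    rw [show M (f (Prog.loop k last body).entry) = _ from hM _]
    simp only [Prog.code, Prog.entry, TM2.stepAux]
    rw [show joinStk S₀ S (Sum.inr k) = [] from hk]
    simp only [List.head?_nil, List.tail_nil]
    rw [update_joinStk_inr, ← hk, Function.update_eq_self]
  | @loop_last k last body S s r hk hs =>
    refine ⟨some s, reachesIn_step ?_⟩
    rw [show M (f (Prog.loop k last body).entry) = _ from hM _]
    simp only [Prog.code, Prog.entry, TM2.stepAux]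
    rw [show joinStk S₀ S (Sum.inr k) = s :: r from hk]
    simp only [List.head?_cons, List.tail_cons, hs, if_true]
    rw [update_joinStk_inr]
  | @loop_step k last body S S' S'' s r t t' hk hs _ _ ih ih' =>
    have h₀ : ReachesIn M ⟨some (f (Prog.loop k last body).entry), (v, o), joinStk S₀ S⟩
        ⟨some (f (.inr ⟨s, (body s).entry⟩)), (v, some s),
          joinStk S₀ (Function.update S k r)⟩ 1 := by
      refine reachesIn_step ?_
      rw [show M (f (Prog.loop k last body).entry) = _ from hM _]
      simp only [Prog.code, Prog.entry, TM2.stepAux]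
      rw [show joinStk S₀ S (Sum.inr k) = s :: r from hk]
      simp only [List.head?_cons, List.tail_cons, hs]
      rw [update_joinStk_inr]
      simp
    obtain ⟨o₁, h₁⟩ := ih (fun l => f (.inr ⟨s, l⟩)) (f (.inl ())) (fun l => hM (.inr ⟨s, l⟩))
      (some s)
    obtain ⟨o₂, h₂⟩ := ih' f exit hM o₁
    exact ⟨o₂, ((h₀.trans h₁).trans h₂).mono (by omega)⟩
  | mono _ ht ih =>
    obtain ⟨o', h⟩ := ih f exit hM o
    exact ⟨o', h.mono ht⟩

end Prog

/-! ### Running a program on the output of a machine -/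

section Comp

variable {K Γ : Type} [DecidableEq K] {K₀ : Type} [DecidableEq K₀] {Γ₀ : K₀ → Type} {σ₀ Λ₀ Λ : Type}

/-- A statement of a machine as a statement of a machine with additional stacks and variables. The
labels are embedded by `f`, and instead of halting the machine jumps to `exit`. -/
def liftStmt (f : Λ₀ → Λ) (exit : Λ) : TM2.Stmt Γ₀ Λ₀ σ₀ →
    TM2.Stmt (JoinAlph Γ₀ K Γ) Λ (σ₀ × Option Γ)
  | .push k g q => .push (Sum.inl k) (fun v => g v.1) (liftStmt f exit q)
  | .peek k g q => .peek (Sum.inl k) (fun v s => (g v.1 s, v.2)) (liftStmt f exit q)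
  | .pop k g q => .pop (Sum.inl k) (fun v s => (g v.1 s, v.2)) (liftStmt f exit q)
  | .load g q => .load (fun v => (g v.1, v.2)) (liftStmt f exit q)
  | .branch g q q' => .branch (fun v => g v.1) (liftStmt f exit q) (liftStmt f exit q')
  | .goto g => .goto fun v => f (g v.1)
  | .halt => .goto fun _ => exit

/-- A configuration as a configuration of a machine with additional stacks and variables. -/
def liftCfg (f : Λ₀ → Λ) (exit : Λ) (o : Option Γ) (S : K → List Γ) (c : TM2.Cfg Γ₀ Λ₀ σ₀) :
    TM2.Cfg (JoinAlph Γ₀ K Γ) Λ (σ₀ × Option Γ) :=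
  ⟨some (c.l.elim exit f), (c.var, o), joinStk c.stk S⟩

theorem stepAux_liftStmt (f : Λ₀ → Λ) (exit : Λ) (o : Option Γ) (S : K → List Γ)
    (q : TM2.Stmt Γ₀ Λ₀ σ₀) (v : σ₀) (S₀ : ∀ k, List (Γ₀ k)) :
    TM2.stepAux (liftStmt f exit q) (v, o) (joinStk S₀ S) =
      liftCfg f exit o S (TM2.stepAux q v S₀) := by
  induction q generalizing v S₀ with
  | push k g q ih =>
    simp only [liftStmt, TM2.stepAux]
    rw [← ih, ← update_joinStk_inl]
    rfl
  | peek k g q ih =>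
    simp only [liftStmt, TM2.stepAux]
    rw [← ih]
    rfl
  | pop k g q ih =>
    simp only [liftStmt, TM2.stepAux]
    rw [← ih, ← update_joinStk_inl]
    rfl
  | load g q ih =>
    simp only [liftStmt, TM2.stepAux]
    rw [← ih]
  | branch g q q' ih ih' =>
    simp only [liftStmt, TM2.stepAux]
    cases g v
    · simp only [cond_false]; rw [ih']
    · simp only [cond_true]; rw [ih]
  | goto g => rfl
  | halt => rfl

/-- One step simulates one step. A halted configuration has no successor, so the jump to `exit` that
replaces halting can occur only at the end of the run. -/
theorem reachesIn_lift {M₀ : Λ₀ → TM2.Stmt Γ₀ Λ₀ σ₀}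
    {M : Λ → TM2.Stmt (JoinAlph Γ₀ K Γ) Λ (σ₀ × Option Γ)} (f : Λ₀ → Λ) (exit : Λ)
    (hM : ∀ l, M (f l) = liftStmt f exit (M₀ l)) (o : Option Γ) (S : K → List Γ) {n : ℕ}
    {c c' : TM2.Cfg Γ₀ Λ₀ σ₀} (h : (flip bind (TM2.step M₀))^[n] (some c) = some c') :
    ReachesIn M (liftCfg f exit o S c) (liftCfg f exit o S c') n := by
  induction n generalizing c' with
  | zero => simp at h; subst h; exact ⟨0, le_rfl, rfl⟩
  | succ n ih =>
    rw [Function.iterate_succ_apply'] at h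
    cases hd : (flip bind (TM2.step M₀))^[n] (some c) with
    | none => rw [hd] at h; simp [flip] at h
    | some d =>
      rw [hd] at h
      refine (ih hd).trans ?_
      obtain ⟨l, v, S₀⟩ := d
      cases l with
      | none => simp [flip] at h
      | some l =>
        simp only [flip, Option.bind_eq_bind, Option.bind_some, TM2.step, Option.some.injEq] at h
        refine reachesIn_step ?_
        simp only [Option.elim]
        rw [hM, stepAux_liftStmt, h]

variable [Inhabited Γ]

/-- The code of a machine that runs the machine `M₀`, moves the contents of the stack `k₁` to the
stack `kin` (in reverse order), runs the program `p`, and halts. -/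
def compCode (M₀ : Λ₀ → TM2.Stmt Γ₀ Λ₀ σ₀) (k₁ : K₀) (e : Γ₀ k₁ ≃ Γ) (p : Prog K Γ) (kin : K) :
    Λ₀ ⊕ (Bool ⊕ p.Label) → TM2.Stmt (JoinAlph Γ₀ K Γ) (Λ₀ ⊕ (Bool ⊕ p.Label))
      (σ₀ × Option Γ)
  | .inl l => liftStmt Sum.inl (.inr (.inl false)) (M₀ l)
  | .inr (.inl false) =>
    .pop (Sum.inl k₁) (fun v s => (v.1, s.map e)) (.branch (fun v => v.2.isSome)
      (.push (Sum.inr kin) (fun v => v.2.getD default) (.goto fun _ => .inr (.inl false)))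
      (.goto fun _ => .inr (.inr p.entry)))
  -- A halting configuration must carry the initial value of the variables, so the symbol left in
  -- the register is erased.
  | .inr (.inl true) => .load (fun v => (v.1, none)) .halt
  | .inr (.inr l) => p.code (fun l => .inr (.inr l)) (.inr (.inl true)) l

/-- Moving a stack symbol by symbol reverses it. The extra step is the pop of the empty stack, which
signals the end. -/
theorem reachesIn_transfer (M₀ : Λ₀ → TM2.Stmt Γ₀ Λ₀ σ₀) (k₁ : K₀) (e : Γ₀ k₁ ≃ Γ) (p : Prog K Γ)
    (kin : K) (v : σ₀) (w : List (Γ₀ k₁)) (o : Option Γ) (S₀ : ∀ k, List (Γ₀ k)) (S : K → List Γ)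
    (hw : S₀ k₁ = w) :
    ∃ o', ReachesIn (compCode M₀ k₁ e p kin) ⟨some (.inr (.inl false)), (v, o), joinStk S₀ S⟩
      ⟨some (.inr (.inr p.entry)), (v, o'), joinStk (Function.update S₀ k₁ [])
        (Function.update S kin ((w.map e).reverse ++ S kin))⟩ (w.length + 1) := by
  induction w generalizing o S₀ S with
  | nil =>
    refine ⟨none, reachesIn_step ?_⟩
    simp only [compCode, TM2.stepAux]
    rw [show joinStk S₀ S (Sum.inl k₁) = [] from hw]
    simp only [List.head?_nil, Option.map_none, Option.isSome_none, cond_false, List.tail_nil,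
      List.map_nil, List.reverse_nil, List.nil_append, Function.update_eq_self]
    rw [update_joinStk_inl]
  | cons s w ih =>
    obtain ⟨o', h⟩ := ih (some (e s)) (Function.update S₀ k₁ w)
      (Function.update S kin (e s :: S kin)) (by simp)
    refine ⟨o', ?_⟩
    have h₀ : ReachesIn (compCode M₀ k₁ e p kin)
        ⟨some (.inr (.inl false)), (v, o), joinStk S₀ S⟩
        ⟨some (.inr (.inl false)), (v, some (e s)), joinStk (Function.update S₀ k₁ w)
          (Function.update S kin (e s :: S kin))⟩ 1 := by
      refine reachesIn_step ?_
      simp only [compCode, TM2.stepAux]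
      rw [show joinStk S₀ S (Sum.inl k₁) = s :: w from hw]
      simp only [List.head?_cons, Option.map_some, Option.isSome_some, cond_true, List.tail_cons,
        Option.getD_some]
      rw [update_joinStk_inl, update_joinStk_inr]
      rfl
    have := h₀.trans h
    simp only [Function.update_idem, Function.update_self] at this
    simpa using this.mono (t' := (s :: w).length + 1) (by simp; omega)

theorem length_initList_le (tm : FinTM2) (l : List (tm.Γ tm.k₀)) (k : tm.K) :
    ((initList tm l).stk k).length ≤ l.length := by
  by_cases hk : k = tm.k₀
  · subst hk; simp [initList]
  · simp [initList, hk]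

theorem eval_mono_nat (q : Polynomial ℕ) : Monotone fun x => q.eval x := by
  intro x y h
  simp only [Polynomial.eval_eq_sum, Polynomial.sum]
  gcongr

/-- If a function is computable in polynomial time, then so is its composition with a program that
runs in polynomial time on the (reversed) values of the function. -/
theorem nonempty_computableInPolyTime_comp [Fintype Γ] [Fintype K] {α β γ αΓ : Type}
    {ea : α → List αΓ} {eb : β → List Γ} {ec : γ → List Γ} {f : α → β} {g : α → γ}
    (h : TM2ComputableInPolyTime ea eb f) (p : Prog K Γ) (kin kout : K) (q : Polynomial ℕ)
    (hp : ∀ a, Runs p (Function.update (fun _ => []) kin (eb (f a)).reverse)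
      (Function.update (fun _ => []) kout (ec (g a))) (q.eval (eb (f a)).length)) :
    Nonempty (TM2ComputableInPolyTime ea ec g) := by
  classical
  have hlab := p.finite_label
  let := Fintype.ofFinite p.Label
  let := h.tm.kFin
  let := h.tm.ΛFin
  let := h.tm.σFin
  let := h.tm.Γk₀Fin
  obtain ⟨P, hP⟩ := exists_length_le_of_iterate h.tm.m h.tm.k₁
  -- Bound on the length of the first machine's output: the length of its input plus at most `P`
  -- symbols for each step.
  let len : Polynomial ℕ := Polynomial.X + Polynomial.C P * h.time
  let tm : FinTM2 :=
    { K := h.tm.K ⊕ K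
      k₀ := Sum.inl h.tm.k₀
      k₁ := Sum.inr kout
      Γ := JoinAlph h.tm.Γ K Γ
      Λ := h.tm.Λ ⊕ (Bool ⊕ p.Label)
      main := Sum.inl h.tm.main
      σ := h.tm.σ × Option Γ
      initialState := (h.tm.initialState, none)
      Γk₀Fin := inferInstanceAs (Fintype (h.tm.Γ h.tm.k₀))
      m := compCode h.tm.m h.tm.k₁ h.outputAlphabet p kin }
  have main : ∀ a, ReachesIn tm.m (initList tm ((ea a).map h.inputAlphabet.invFun))
      (haltList tm (ec (g a)))
      (h.time.eval (ea a).length + (len.eval (ea a).length + 1) +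
        q.eval (len.eval (ea a).length) + 1) := by
    intro a
    obtain ⟨⟨n, hn⟩, hnt⟩ := h.outputsFun a
    simp only [Option.map_some] at hn
    have hlen : (eb (f a)).length ≤ len.eval (ea a).length := by
      have h₁ := hP n _ _ hn
      have h₂ : P * n ≤ P * h.time.eval (ea a).length := Nat.mul_le_mul_left P hnt
      have h₀ : ((initList h.tm ((ea a).map h.inputAlphabet.invFun)).stk h.tm.k₁).length ≤
          (ea a).length := by
        simpa using length_initList_le h.tm ((ea a).map h.inputAlphabet.invFun) h.tm.k₁
      have h₃ : ((haltList h.tm ((eb (f a)).map h.outputAlphabet.invFun)).stk h.tm.k₁).length =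
          (eb (f a)).length := by
        simp [haltList]
      rw [h₃] at h₁
      simp only [len, Polynomial.eval_add, Polynomial.eval_X, Polynomial.eval_mul,
        Polynomial.eval_C]
      omega
    have h₁ : ReachesIn tm.m _ _ n :=
      reachesIn_lift (M := tm.m) Sum.inl (.inr (.inl false)) (fun _ => rfl) none
        (fun _ => ([] : List Γ)) hn
    obtain ⟨o, h₂⟩ := reachesIn_transfer h.tm.m h.tm.k₁ h.outputAlphabet p kin
      h.tm.initialState ((eb (f a)).map h.outputAlphabet.invFun) none
      (haltList h.tm ((eb (f a)).map h.outputAlphabet.invFun)).stk (fun _ => [])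
      (by simp [haltList])
    have hmap : ((eb (f a)).map h.outputAlphabet.invFun).map h.outputAlphabet = eb (f a) := by
      simp [Function.comp_def]
    rw [hmap, List.append_nil] at h₂
    obtain ⟨o', h₃⟩ := (hp a).reachesIn (M := tm.m) (fun l => .inr (.inr l)) (.inr (.inl true))
      (fun _ => rfl) h.tm.initialState o
      (Function.update (haltList h.tm ((eb (f a)).map h.outputAlphabet.invFun)).stk h.tm.k₁ [])
    have h₄ : ReachesIn tm.m ⟨some (.inr (.inl true)), (h.tm.initialState, o'),
        joinStk (Function.update
          (haltList h.tm ((eb (f a)).map h.outputAlphabet.invFun)).stk h.tm.k₁ [])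
          (Function.update (fun _ => []) kout (ec (g a)))⟩ (haltList tm (ec (g a))) 1 := by
      refine reachesIn_step ?_
      have hs : joinStk (Function.update
          (haltList h.tm ((eb (f a)).map h.outputAlphabet.invFun)).stk h.tm.k₁ [])
          (Function.update (fun _ => []) kout (ec (g a))) = (haltList tm (ec (g a))).stk := by
        funext k
        rcases k with k | k
        · by_cases hk : k = h.tm.k₁
          · subst hk; simp [joinStk, haltList, tm]
          · simp [joinStk, haltList, tm, hk]
        · by_cases hk : k = kout
          · subst hk; simp [joinStk, haltList, tm]
          · simp [joinStk, haltList, tm, hk]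
      rw [hs]
      rfl
    have h₀ : initList tm ((ea a).map h.inputAlphabet.invFun) =
        liftCfg Sum.inl (.inr (.inl false)) none (fun _ => ([] : List Γ))
          (initList h.tm ((ea a).map h.inputAlphabet.invFun)) := by
      have hs : (initList tm ((ea a).map h.inputAlphabet.invFun)).stk =
          joinStk (initList h.tm ((ea a).map h.inputAlphabet.invFun)).stk
            (fun _ => ([] : List Γ)) := by
        funext k
        rcases k with k | k
        · by_cases hk : k = h.tm.k₀
          · subst hk; simp [joinStk, initList, tm]
          · simp [joinStk, initList, tm, hk]
        · simp [joinStk, initList, tm]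
      simp only [liftCfg]
      rw [← hs]
      rfl
    rw [h₀]
    refine (((h₁.trans h₂).trans h₃).trans h₄).mono ?_
    have := eval_mono_nat q hlen
    simp only [List.length_map] at this hnt ⊢
    omega
  choose n hn hsteps using main
  refine ⟨{
    tm := tm
    inputAlphabet := h.inputAlphabet
    outputAlphabet := Equiv.refl Γ
    time := h.time + (len + 1) + q.comp len + 1
    outputsFun := fun a => ⟨⟨n a, ?_⟩, ?_⟩ }⟩
  · exact (hsteps a).trans (by simp [tm]; rfl)
  · refine (hn a).trans (le_of_eq ?_)
    simp

end Comp

end StackMachine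

namespace QCrypto

/-! ### The verification by projection -/

/-- The gate `g` on other wires. -/
def Gate.map {w v : ℕ} (e : Fin w ↪ Fin v) : Gate w → Gate v
  | .x a => .x (e a)
  | .h a => .h (e a)
  | .t a => .t (e a)
  | .tdg a => .tdg (e a)
  | .cnot c a hca => .cnot (e c) (e a) (e.injective.ne hca)
  | .tof c d a hcd hca hda =>
    .tof (e c) (e d) (e a) (e.injective.ne hcd) (e.injective.ne hca) (e.injective.ne hda)

/-- The inverse of a gate. -/
def Gate.inv {w : ℕ} : Gate w → Gate w
  | .t a => .tdg a
  | .tdg a => .t a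
  | g => g

namespace QCircuit

variable {a b : ℕ} (C : QCircuit a b)

/-- The width of the circuit `C.projVer`. Its wires are: `a` wires for the input `k` of `C`, `b`
wires for a state, a block of `C.width` wires, an unused wire, and `C.width + 1` flags. -/
def projWidth : ℕ := a + b + C.width + 1 + C.width + 1

/-- The wires that carry the input of `C`. -/
def keyWire (i : Fin a) : Fin C.projWidth :=
  ⟨i, by have := i.isLt; unfold projWidth; omega⟩

/-- The wires that carry the state to be measured. -/
def stateWire (i : Fin b) : Fin C.projWidth :=
  ⟨a + i, by have := i.isLt; unfold projWidth; omega⟩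

/-- The wires on which `C` is run. -/
def blockWire : Fin C.width ↪ Fin C.projWidth where
  toFun i := ⟨a + b + i, by have := i.isLt; unfold projWidth; omega⟩
  inj' i j h := by simpa [Fin.ext_iff] using h

/-- The flag wires: the `i`-th flag tells whether the first `i` wires of the block are zero. -/
def flagWire (i : Fin (C.width + 1)) : Fin C.projWidth :=
  ⟨a + b + C.width + 1 + i, by have := i.isLt; unfold projWidth; omega⟩

@[simp]
theorem val_keyWire (i : Fin a) : (C.keyWire i : ℕ) = i := rfl

@[simp]
theorem val_stateWire (i : Fin b) : (C.stateWire i : ℕ) = a + i := rfl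

@[simp]
theorem val_blockWire (i : Fin C.width) : (C.blockWire i : ℕ) = a + b + i := rfl

@[simp]
theorem val_flagWire (i : Fin (C.width + 1)) : (C.flagWire i : ℕ) = a + b + C.width + 1 + i := rfl

/-- The output wire. -/
def outWire : Fin C.projWidth := ⟨0, by unfold projWidth; omega⟩

@[simp]
theorem val_outWire : (C.outWire : ℕ) = 0 := rfl

/-- The gates that add the input of `C` to the block. -/
def copyGates : List (Gate C.projWidth) :=
  (List.finRange a).map fun i => .cnot (C.keyWire i) (C.blockWire (Fin.castLE C.nin_le i)) (by
    have := i.isLt; simp only [ne_eq, Fin.ext_iff]; simp; omega)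

/-- The gates that swap the state with the output wires of `C` in the block. -/
def swapGates : List (Gate C.projWidth) :=
  (List.finRange b).flatMap fun i =>
    have h : C.stateWire i ≠ C.blockWire (Fin.castLE C.nout_le i) := by
      have := i.isLt; simp only [ne_eq, Fin.ext_iff]; simp; omega
    [.cnot (C.stateWire i) (C.blockWire (Fin.castLE C.nout_le i)) h,
      .cnot (C.blockWire (Fin.castLE C.nout_le i)) (C.stateWire i) h.symm,
      .cnot (C.stateWire i) (C.blockWire (Fin.castLE C.nout_le i)) h]

/-- The gates that negate the block. -/
def notGates : List (Gate C.projWidth) :=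
  (List.finRange C.width).map fun i => .x (C.blockWire i)

/-- The gates that compute the flags from the negated block. -/
def flagGates : List (Gate C.projWidth) :=
  (List.finRange C.width).map fun i =>
    .tof (C.blockWire i) (C.flagWire i.castSucc) (C.flagWire i.succ)
      (by have := i.isLt; simp only [ne_eq, Fin.ext_iff]; simp; omega)
      (by have := i.isLt; simp only [ne_eq, Fin.ext_iff]; simp; omega)
      (by simp only [ne_eq, Fin.ext_iff]; simp)

/-- The gates that move the last flag to the output wire. -/
def outGates : List (Gate C.projWidth) :=
  have h : C.outWire ≠ C.flagWire (Fin.last _) := by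
    simp only [ne_eq, Fin.ext_iff]; simp; omega
  -- The first gate adds the old content of the output wire to the flag, so that the second cancels
  -- this content and leaves the flag alone. The unused wire guarantees that the two wires differ
  -- even if `a`, `b` and `C.width` all vanish.
  [.cnot C.outWire (C.flagWire (Fin.last _)) h, .cnot (C.flagWire (Fin.last _)) C.outWire h.symm]

/-- The circuit that, on input `k` and a state, runs `C` on `k`, swaps the output with the state,
runs `C` backwards, and tests whether the result is `k`. -/
def projVer : QCircuit (a + b) 1 where
  width := C.projWidth
  nin_le := by unfold projWidth; omega
  nout_le := by unfold projWidth; omega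
  gates :=
    C.copyGates ++ C.gates.map (Gate.map C.blockWire) ++ C.swapGates ++
      C.gates.reverse.map (fun g => g.inv.map C.blockWire) ++ C.copyGates ++ C.notGates ++
      [.x (C.flagWire 0)] ++ C.flagGates ++ C.outGates

end QCircuit

/-! ### The description of the verification by projection -/

/-- The description of a gate list after a shift of the wires by `n`. -/
def shiftWord (n : ℕ) (l : List Symb) : List Symb :=
  l.flatMap fun s => if s = .sep then List.replicate n .one ++ [.sep] else [s]

theorem shiftWord_append (n : ℕ) (l l' : List Symb) :
    shiftWord n (l ++ l') = shiftWord n l ++ shiftWord n l' := by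
  simp [shiftWord]

/-- A number is in unary and ends with its only separator, so inserting `n` ones before each
separator adds `n` to every wire number. -/
theorem shiftWord_encNat (n i : ℕ) : shiftWord n (encNat i) = encNat (n + i) := by
  have : ∀ i, shiftWord n (List.replicate i .one) = List.replicate i .one := by
    intro i
    induction i with
    | zero => rfl
    | succ i ih => rw [List.replicate_succ]; simpa [shiftWord] using ih
  rw [encNat, shiftWord_append, this, encNat, add_comm n i, List.replicate_add]
  simp [shiftWord, ← List.append_assoc]

theorem shiftWord_cons {n : ℕ} {s : Symb} (hs : s ≠ .sep) (l : List Symb) :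
    shiftWord n (s :: l) = s :: shiftWord n l := by
  simp [shiftWord, hs]

theorem Gate.encode_map {w v n : ℕ} (e : Fin w ↪ Fin v) (he : ∀ i, (e i : ℕ) = n + i)
    (g : Gate w) : (g.map e).encode = shiftWord n g.encode := by
  cases g <;> simp [Gate.map, Gate.encode, shiftWord_cons, shiftWord_append, shiftWord_encNat, he]

theorem flatMap_encode_map {w v n : ℕ} (e : Fin w ↪ Fin v) (he : ∀ i, (e i : ℕ) = n + i)
    (l : List (Gate w)) :
    (l.map (Gate.map e)).flatMap Gate.encode = shiftWord n (l.flatMap Gate.encode) := by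
  induction l with
  | nil => rfl
  | cons g l ih =>
    rw [List.map_cons, List.flatMap_cons, List.flatMap_cons, shiftWord_append, ih,
      Gate.encode_map e he]

theorem flatMap_finRange {α : Type*} (n : ℕ) (f : ℕ → List α) :
    (List.finRange n).flatMap (fun i : Fin n => f i.val) = (List.range n).flatMap f := by
  rw [← List.map_coe_finRange_eq_range, List.flatMap_map]

/-- The description of `C.projVer` in terms of the description of `C`. -/
theorem QCircuit.encode_projVer {a b : ℕ} (C : QCircuit a b) :
    C.projVer.encode =
      encNat (a + b) ++ encNat 1 ++ encNat (a + b + C.width + 1 + C.width + 1) ++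
      (List.range a).flatMap (fun i => .cnot :: (encNat i ++ encNat (a + b + i))) ++
      shiftWord (a + b) (C.gates.flatMap Gate.encode) ++
      (List.range b).flatMap (fun i =>
        .cnot :: (encNat (a + i) ++ encNat (a + b + i)) ++
        .cnot :: (encNat (a + b + i) ++ encNat (a + i)) ++
        .cnot :: (encNat (a + i) ++ encNat (a + b + i))) ++
      shiftWord (a + b) ((C.gates.reverse.map Gate.inv).flatMap Gate.encode) ++
      (List.range a).flatMap (fun i => .cnot :: (encNat i ++ encNat (a + b + i))) ++
      (List.range C.width).flatMap (fun i => .x :: encNat (a + b + i)) ++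
      .x :: encNat (a + b + C.width + 1) ++
      (List.range C.width).flatMap (fun i => .tof :: (encNat (a + b + i) ++
        encNat (a + b + C.width + 1 + i) ++ encNat (a + b + C.width + 1 + (i + 1)))) ++
      (.cnot :: (encNat 0 ++ encNat (a + b + C.width + 1 + C.width)) ++
        .cnot :: (encNat (a + b + C.width + 1 + C.width) ++ encNat 0)) := by
  have h₁ : C.copyGates.flatMap Gate.encode =
      (List.range a).flatMap (fun i => .cnot :: (encNat i ++ encNat (a + b + i))) := by
    rw [← flatMap_finRange, copyGates, List.flatMap_map]; rfl
  have h₂ : C.notGates.flatMap Gate.encode =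
      (List.range C.width).flatMap (fun i => .x :: encNat (a + b + i)) := by
    rw [← flatMap_finRange, notGates, List.flatMap_map]; rfl
  have h₃ : C.flagGates.flatMap Gate.encode =
      (List.range C.width).flatMap (fun i => .tof :: (encNat (a + b + i) ++
        encNat (a + b + C.width + 1 + i) ++ encNat (a + b + C.width + 1 + (i + 1)))) := by
    rw [← flatMap_finRange, flagGates, List.flatMap_map]; rfl
  have h₄ : C.swapGates.flatMap Gate.encode = (List.range b).flatMap (fun i =>
        .cnot :: (encNat (a + i) ++ encNat (a + b + i)) ++
        .cnot :: (encNat (a + b + i) ++ encNat (a + i)) ++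
        .cnot :: (encNat (a + i) ++ encNat (a + b + i))) := by
    rw [← flatMap_finRange, swapGates, List.flatMap_assoc]
    simp [Gate.encode]
  have he : ∀ i, (C.blockWire i : ℕ) = a + b + i := fun i => rfl
  have h₅ : (C.gates.reverse.map fun g => g.inv.map C.blockWire) =
      (C.gates.reverse.map Gate.inv).map (Gate.map C.blockWire) := by
    rw [List.map_map]; rfl
  simp only [QCircuit.encode, projVer, List.flatMap_append, h₁, h₂, h₃, h₄, h₅,
    flatMap_encode_map _ he]
  simp [outGates, Gate.encode, projWidth]

end QCrypto

namespace QCrypto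

open StackMachine

/-! ### A program that describes the verification by projection -/

instance : Inhabited Symb := ⟨.one⟩

instance : Fintype Symb where
  elems := {.one, .sep, .x, .h, .t, .tdg, .cnot, .tof}
  complete s := by cases s <;> decide

/-- The stacks of the program. -/
inductive Reg : Type
  | inp | gates | buf | out | tmp | numIn | numOut | width | idx
  deriving DecidableEq

instance : Fintype Reg where
  elems := {.inp, .gates, .buf, .out, .tmp, .numIn, .numOut, .width, .idx}
  complete r := by cases r <;> decide

/-- The natural number `n`, as the contents of a stack. -/
abbrev ones (n : ℕ) : List Symb := List.replicate n Symb.one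

/-- Loop rule with an invariant: `inv d r` gives the stacks when `d` ones have been consumed and `r`
remain. The body starts after a pop, hence the update of `k`; the equation `d + r + 1 = n` lets it
use that the counter is bounded. -/
theorem runs_loop_ctr {k : Reg} {body : Symb → Prog Reg Symb} {n t : ℕ}
    (inv : ℕ → ℕ → Reg → List Symb) (hk : ∀ d r, inv d r k = ones r)
    (hstep : ∀ d r, d + r + 1 = n →
      Runs (body .one) (Function.update (inv d (r + 1)) k (ones r)) (inv (d + 1) r) t) :
    Runs (.loop k (fun _ => false) body) (inv 0 n) (inv n 0) (n * (t + 1) + 1) := by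
  have : ∀ r d, d + r = n →
      Runs (.loop k (fun _ => false) body) (inv d r) (inv n 0) (r * (t + 1) + 1) := by
    intro r
    induction r with
    | zero =>
      rintro d rfl
      exact (Runs.loop_nil (hk _ _)).mono (by omega)
    | succ r ih =>
      intro d hd
      refine (Runs.loop_step (hk d (r + 1)) rfl (hstep d r (by omega))
        (ih (d + 1) (by omega))).mono ?_
      rw [Nat.succ_mul]
      omega
  exact this n 0 (by omega)

/-- The analogous rule for words, with `d` read and `r` unread. The equation in `hstep` bounds the
length of the part already read. -/
theorem runs_loop_list {k : Reg} {body : Symb → Prog Reg Symb} {t : ℕ} {l : List Symb}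
    (inv : List Symb → List Symb → Reg → List Symb) (hk : ∀ d r, inv d r k = r)
    (hstep : ∀ d s r, d ++ s :: r = l →
      Runs (body s) (Function.update (inv d (s :: r)) k r) (inv (d ++ [s]) r) t) :
    Runs (.loop k (fun _ => false) body) (inv [] l) (inv l []) (l.length * (t + 1) + 1) := by
  have : ∀ r d, d ++ r = l →
      Runs (.loop k (fun _ => false) body) (inv d r) (inv l []) (r.length * (t + 1) + 1) := by
    intro r
    induction r with
    | nil =>
      rintro d rfl
      rw [List.append_nil]
      exact (Runs.loop_nil (hk _ _)).mono (by omega)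
    | cons s r ih =>
      intro d hd
      refine (Runs.loop_step (hk d (s :: r)) rfl (hstep d s r hd)
        (ih (d ++ [s]) (by simpa using hd))).mono ?_
      rw [List.length_cons, Nat.succ_mul]
      omega
  exact this l [] rfl

/-- Push the number on the stack `c` onto the stack `d`. -/
def copyCtr (c d : Reg) : Prog Reg Symb :=
  .seq (.loop c (fun _ => false) fun _ => .seq (.push .tmp .one) (.push d .one))
    (.loop .tmp (fun _ => false) fun _ => .push c .one)

/-- Reading a stack destroys it, so the ones are sent both to `d` and to `tmp`, and then brought
back from `tmp`. The two loops cost `3 * n + 1` and `2 * n + 1`. -/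
theorem runs_copyCtr {c d : Reg} {n : ℕ} {S : Reg → List Symb} (hc : S c = ones n)
    (ht : S .tmp = []) (hct : c ≠ .tmp) (hdt : d ≠ .tmp) (hcd : c ≠ d) :
    Runs (copyCtr c d) S (Function.update S d (ones n ++ S d)) (5 * n + 2) := by
  have h₁ := runs_loop_ctr (k := c) (n := n)
    (body := fun _ => .seq (.push .tmp .one) (.push d .one))
    (fun i r => Function.update (Function.update (Function.update S c (ones r)) .tmp (ones i)) d
      (ones i ++ S d)) (t := 1 + 1) (by
      intro i r
      rw [Function.update_of_ne hcd, Function.update_of_ne hct, Function.update_self]) (by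
      intro i r _
      refine Runs.seq (Runs.push _ _ _) ?_
      convert Runs.push d Symb.one _ using 1
      funext x
      simp only [Function.update_apply, ones]
      grind)
  have h₂ := runs_loop_ctr (k := .tmp) (n := n) (body := fun _ => .push c .one)
    (fun i r => Function.update (Function.update (Function.update S c (ones i)) .tmp (ones r)) d
      (ones n ++ S d)) (t := 1) (by
      intro i r
      rw [Function.update_of_ne hdt.symm, Function.update_self]) (by
      intro i r _
      convert Runs.push c Symb.one _ using 1
      funext x
      simp only [Function.update_apply, ones]
      grind)
  have h₀ : S = Function.update (Function.update (Function.update S c (ones n)) .tmp (ones 0)) d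
      (ones 0 ++ S d) := by
    funext x
    simp only [Function.update_apply, ones]
    grind
  have h₃ : Function.update S d (ones n ++ S d) = Function.update (Function.update
      (Function.update S c (ones n)) .tmp (ones 0)) d (ones n ++ S d) := by
    funext x
    simp only [Function.update_apply, ones]
    grind
  rw [h₃]
  conv => arg 2; rw [h₀]
  exact (h₁.seq h₂).mono (by omega)

/-- Items to be written: symbols and numbers on stacks. -/
inductive Item : Type
  | lit (s : Symb)
  | ctr (c : Reg)

/-- The text of an item. -/
def Item.text (S : Reg → List Symb) : Item → List Symb
  | .lit s => [s]
  | .ctr c => S c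

/-- The program that writes an item. -/
def Item.emit : Item → Prog Reg Symb
  | .lit s => .push .out s
  | .ctr c => copyCtr c .out

/-- The program that writes a list of items. -/
def emit : List Item → Prog Reg Symb
  | [] => .nop
  -- The tail is written first, since whatever is pushed later stands in front.
  | i :: l => .seq (emit l) i.emit

/-- The stack `tmp` is free, and the stacks `numIn`, `numOut`, `width` and `idx` hold numbers that
are at most `L`. -/
structure Good (L : ℕ) (S : Reg → List Symb) : Prop where
  tmp : S .tmp = []
  ctr : ∀ c ∈ [Reg.numIn, .numOut, .width, .idx], ∃ n ≤ L, S c = ones n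

theorem Good.update_out {L : ℕ} {S : Reg → List Symb} (h : Good L S) (l : List Symb) :
    Good L (Function.update S .out l) := by
  refine ⟨by simp [h.tmp], fun c hc => ?_⟩
  rw [Function.update_of_ne (by rintro rfl; simp at hc)]
  exact h.ctr c hc

theorem Good.update_idx {L : ℕ} {S : Reg → List Symb} (h : Good L S) {n : ℕ} (hn : n ≤ L) :
    Good L (Function.update S .idx (ones n)) := by
  refine ⟨by simp [h.tmp], fun c hc => ?_⟩
  by_cases hi : c = .idx
  · subst hi; exact ⟨n, hn, by simp⟩
  · rw [Function.update_of_ne hi]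
    exact h.ctr c hc

/-- The items that refer to numbers on stacks refer to the right stacks. -/
def ItemsOk (l : List Item) : Prop :=
  ∀ i ∈ l, ∀ c, i = .ctr c → c ∈ [Reg.numIn, .numOut, .width, .idx]

theorem runs_item {L : ℕ} {S : Reg → List Symb} (h : Good L S) {i : Item} (hi : ItemsOk [i]) :
    Runs i.emit S (Function.update S .out (i.text S ++ S .out)) (5 * L + 2) := by
  cases i with
  | lit s => exact (Runs.push _ _ _).mono (by omega)
  | ctr c =>
    have hc := hi (.ctr c) (by simp) c rfl
    obtain ⟨n, hn, hS⟩ := h.ctr c hc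
    have := runs_copyCtr (d := .out) hS h.tmp (by rintro rfl; simp at hc) (by simp)
      (by rintro rfl; simp at hc)
    simp only [Item.text, hS]
    exact this.mono (by omega)

theorem runs_emit {L : ℕ} {S : Reg → List Symb} (h : Good L S) {l : List Item} (hl : ItemsOk l) :
    Runs (emit l) S (Function.update S .out (l.flatMap (Item.text S) ++ S .out))
      (l.length * (5 * L + 2) + 1) := by
  induction l with
  | nil => simpa [emit] using Runs.nop S
  | cons i l ih =>
    have h₁ := ih fun j hj => hl j (by simp [hj])
    have h₂ := runs_item (h.update_out (l.flatMap (Item.text S) ++ S .out)) (i := i)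
      fun j hj => hl j (by simp at hj; simp [hj])
    refine (h₁.seq ?_).mono (t := l.length * (5 * L + 2) + 1 + (5 * L + 2)) ?_
    · convert h₂ using 1
      have : i.text (Function.update S .out (l.flatMap (Item.text S) ++ S .out)) = i.text S := by
        cases i with
        | lit s => rfl
        | ctr c =>
          have hc := hl (.ctr c) (by simp) c rfl
          exact Function.update_of_ne (by rintro rfl; simp at hc) _ _
      simp [this]
    · rw [List.length_cons, Nat.succ_mul l.length]
      omega

/-- Write a list of items for every number `i` below the number on the stack `c`; the items may
refer to `i` as the number on the stack `idx`. -/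
def forCtr (c : Reg) (l : List Item) : Prog Reg Symb :=
  .seq (copyCtr c .idx) (.loop .idx (fun _ => false) fun _ => emit l)

/-- After a pop the stack `idx` holds the current index, which runs downwards from `n - 1`. As text
is prepended, the pieces end up in increasing order, and `idx` is empty again at the end. -/
theorem runs_forCtr {L n : ℕ} {S : Reg → List Symb} (h : Good L S) (hidx : S .idx = [])
    {c : Reg} (hcm : c ∈ [Reg.numIn, .numOut, .width]) (hc : S c = ones n) (hn : n ≤ L)
    {l : List Item} (hl : ItemsOk l) :
    Runs (forCtr c l) S (Function.update S .out ((List.range n).flatMap (fun i =>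
      l.flatMap (Item.text (Function.update S .idx (ones i)))) ++ S .out))
      (5 * L + 2 + (L * (l.length * (5 * L + 2) + 1 + 1) + 1)) := by
  have h₁ := runs_copyCtr (d := .idx) hc h.tmp (by rintro rfl; simp at hcm) (by simp)
    (by rintro rfl; simp at hcm)
  let f : ℕ → List Symb := fun i => l.flatMap (Item.text (Function.update S .idx (ones i)))
  have h₂ := runs_loop_ctr (k := .idx) (n := n) (body := fun _ => emit l)
    (fun _ r => Function.update (Function.update S .idx (ones r)) .out
      (((List.range n).drop r).flatMap f ++ S .out)) (t := l.length * (5 * L + 2) + 1)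
    (by intro d r; simp) (by
      intro d r hr
      have hg := (h.update_idx (n := r) (by omega)).update_out
        (((List.range n).drop (r + 1)).flatMap f ++ S .out)
      convert runs_emit hg hl using 1
      · funext x
        simp only [Function.update_apply]
        grind
      · rw [List.drop_eq_getElem_cons (by simp; omega)]
        have : ∀ o, l.flatMap (Item.text (Function.update (Function.update S .idx (ones r)) .out o))
            = f r := by
          intro o
          refine List.flatMap_congr fun i hi => ?_
          cases i with
          | lit s => rfl
          | ctr c =>
            have hc := hl _ hi c rfl
            exact Function.update_of_ne (by rintro rfl; simp at hc) _ _
        rw [this]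
        simp)
  have h₃ := h₁.seq (S'' := Function.update S .out ((List.range n).flatMap f ++ S .out))
    (by
      convert h₂ using 1
      · funext x
        simp only [Function.update_apply, hidx]
        have : (List.range n).drop n = [] := by simp
        grind
      · funext x
        simp only [Function.update_apply]
        grind)
  refine h₃.mono ?_
  gcongr

end QCrypto

/-! ### Subroutines: reading numbers, shifting wires, inverting a gate list. -/

namespace QCrypto

open StackMachine

/-- The stacks of the program, given by their contents; the stacks `tmp` and `idx` are empty. -/
def regs (a b w : ℕ) (inp gates buf out : List Symb) : Reg → List Symb
  | .inp => inp
  | .gates => gates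
  | .buf => buf
  | .out => out
  | .tmp => []
  | .numIn => ones a
  | .numOut => ones b
  | .width => ones w
  | .idx => []

section Regs

variable (a b w : ℕ) (inp gates buf out l : List Symb) (n : ℕ)

@[simp]
theorem update_regs_inp : Function.update (regs a b w inp gates buf out) .inp l =
    regs a b w l gates buf out := by funext r; cases r <;> rfl

@[simp]
theorem update_regs_gates : Function.update (regs a b w inp gates buf out) .gates l =
    regs a b w inp l buf out := by funext r; cases r <;> rfl

@[simp]
theorem update_regs_buf : Function.update (regs a b w inp gates buf out) .buf l =
    regs a b w inp gates l out := by funext r; cases r <;> rfl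

@[simp]
theorem update_regs_out : Function.update (regs a b w inp gates buf out) .out l =
    regs a b w inp gates buf l := by funext r; cases r <;> rfl

@[simp]
theorem update_regs_numIn : Function.update (regs a b w inp gates buf out) .numIn (ones n) =
    regs n b w inp gates buf out := by funext r; cases r <;> rfl

@[simp]
theorem update_regs_numOut : Function.update (regs a b w inp gates buf out) .numOut (ones n) =
    regs a n w inp gates buf out := by funext r; cases r <;> rfl

@[simp]
theorem update_regs_width : Function.update (regs a b w inp gates buf out) .width (ones n) =
    regs a b n inp gates buf out := by funext r; cases r <;> rfl

theorem update_empty_out : Function.update (fun _ => []) Reg.out l = regs 0 0 0 [] [] [] l := by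
  funext r; cases r <;> rfl

theorem update_empty_inp : Function.update (fun _ => []) Reg.inp l = regs 0 0 0 l [] [] [] := by
  funext r; cases r <;> rfl

variable {a b w}

theorem good_regs {L : ℕ} (ha : a ≤ L) (hb : b ≤ L) (hw : w ≤ L) :
    Good L (regs a b w inp gates buf out) := by
  refine ⟨rfl, fun c hc => ?_⟩
  fin_cases hc
  · exact ⟨a, ha, rfl⟩
  · exact ⟨b, hb, rfl⟩
  · exact ⟨w, hw, rfl⟩
  · exact ⟨0, by omega, rfl⟩

end Regs

/-- Reverse the stack `inp` onto the stack `gates`. -/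
def moveInp : Prog Reg Symb := .loop .inp (fun _ => false) fun s => .push .gates s

/-- Undoes the reversal caused by the transfer from the first machine, so that the description can
be parsed from its beginning. -/
theorem runs_moveInp (l : List Symb) :
    Runs moveInp (regs 0 0 0 l.reverse [] [] []) (regs 0 0 0 [] l [] [])
      (l.length * (1 + 1) + 1) := by
  have := runs_loop_list (k := .inp) (l := l.reverse) (body := fun s => .push .gates s)
    (fun d r => regs 0 0 0 r d.reverse [] []) (t := 1) (fun _ _ => rfl) (by
      intro d s r _
      convert Runs.push Reg.gates s _ using 1
      simp [regs])
  simpa [moveInp] using this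

/-- Read a number from the stack `gates` into the stack `c`. -/
def readNat (c : Reg) : Prog Reg Symb := .loop .gates (fun s => s = .sep) fun _ => .push c .one

theorem runs_readNat {c : Reg} (hc : c ≠ .gates) (n : ℕ) {r : List Symb} {S : Reg → List Symb}
    (hS : S .gates = encNat n ++ r) :
    Runs (readNat c) S (Function.update (Function.update S c (ones n ++ S c)) .gates r)
      (2 * n + 1) := by
  unfold readNat
  induction n generalizing S with
  | zero =>
    have : Function.update (Function.update S c (ones 0 ++ S c)) .gates r =
        Function.update S .gates r := by simp
    rw [this]
    exact (Runs.loop_last (by rw [hS]; rfl) (by simp)).mono (by omega)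
  | succ n ih =>
    have hS' : S .gates = .one :: (encNat n ++ r) := by rw [hS]; rfl
    refine Runs.mono (t := 1 + (2 * n + 1) + 1)
      (Runs.loop_step hS' (by simp) (Runs.push _ _ _) ?_) (by omega)
    convert ih _ using 1
    · funext x
      have : ones (n + 1) ++ S c = ones n ++ .one :: S c := by
        rw [ones, List.replicate_succ']; simp
      simp only [Function.update_apply, this]
      grind
    · rw [Function.update_of_ne hc.symm, Function.update_self]

/-- Empty the stack `c`. -/
def clear (c : Reg) : Prog Reg Symb := .loop c (fun _ => false) fun _ => .nop

theorem runs_clear {c : Reg} {n : ℕ} {S : Reg → List Symb} (hS : S c = ones n) :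
    Runs (clear c) S (Function.update S c (ones 0)) (n * (1 + 1) + 1) := by
  have := runs_loop_ctr (k := c) (n := n) (body := fun _ => .nop)
    (fun _ r => Function.update S c (ones r)) (t := 1) (by simp) (by
      intro d r _
      rw [Function.update_idem]
      exact Runs.nop _)
  rw [← hS, Function.update_eq_self] at this
  exact this

/-- Write one symbol of the description of a gate, shifting wires. -/
def shiftSymb (s : Symb) : Prog Reg Symb :=
  if s = .sep then emit [.ctr .numIn, .ctr .numOut, .lit .sep] else .push .out s

/-- Write the gates on the stack `k`, whose description is reversed, shifting wires. -/
def writeShifted (k : Reg) : Prog Reg Symb := .loop k (fun _ => false) shiftSymb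

theorem runs_shiftSymb {a b w L : ℕ} (ha : a ≤ L) (hb : b ≤ L) (hw : w ≤ L)
    (inp gates buf out : List Symb) (s : Symb) :
    Runs (shiftSymb s) (regs a b w inp gates buf out)
      (regs a b w inp gates buf (shiftWord (a + b) [s] ++ out)) (3 * (5 * L + 2) + 1) := by
  unfold shiftSymb
  split_ifs with hs
  · subst hs
    have := runs_emit (good_regs inp gates buf out ha hb hw)
      (l := [.ctr .numIn, .ctr .numOut, .lit .sep]) (by simp [ItemsOk])
    convert this using 1
    · simp [Item.text, regs, shiftWord]
      rw [List.replicate_add, List.append_assoc]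
    · rfl
  · refine Runs.mono (t := 1) ?_ (by omega)
    convert Runs.push Reg.out s _ using 1
    simp [regs, shiftWord, hs]

/-- Reading from the top and prepending to `out` reverses the order; this is why gates are stored in
reverse on the stack. -/
theorem runs_writeShifted_buf {a b w L : ℕ} (ha : a ≤ L) (hb : b ≤ L) (hw : w ≤ L)
    (inp gates buf out : List Symb) :
    Runs (writeShifted .buf) (regs a b w inp gates buf out)
      (regs a b w inp gates [] (shiftWord (a + b) buf.reverse ++ out))
      (buf.length * (3 * (5 * L + 2) + 1 + 1) + 1) := by
  refine runs_loop_list (k := .buf) (l := buf) (body := shiftSymb)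
    (fun d r => regs a b w inp gates r (shiftWord (a + b) d.reverse ++ out)) (fun _ _ => rfl) ?_
  intro d s r _
  convert runs_shiftSymb ha hb hw inp gates r (shiftWord (a + b) d.reverse ++ out) s using 1
  · simp
  · simp [← List.append_assoc, ← shiftWord_append]

theorem runs_writeShifted_inp {a b w L : ℕ} (ha : a ≤ L) (hb : b ≤ L) (hw : w ≤ L)
    (inp gates buf out : List Symb) :
    Runs (writeShifted .inp) (regs a b w inp gates buf out)
      (regs a b w [] gates buf (shiftWord (a + b) inp.reverse ++ out))
      (inp.length * (3 * (5 * L + 2) + 1 + 1) + 1) := by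
  refine runs_loop_list (k := .inp) (l := inp) (body := shiftSymb)
    (fun d r => regs a b w r gates buf (shiftWord (a + b) d.reverse ++ out)) (fun _ _ => rfl) ?_
  intro d s r _
  convert runs_shiftSymb ha hb hw r gates buf (shiftWord (a + b) d.reverse ++ out) s using 1
  · simp
  · simp [← List.append_assoc, ← shiftWord_append]

/-- The symbol of the inverse of a gate. -/
def Symb.inv : Symb → Symb
  | .t => .tdg
  | .tdg => .t
  | s => s

/-- The effect of `invSymb` on the stacks `buf` and `out`. -/
def invStep (n : ℕ) (p : List Symb × List Symb) (s : Symb) : List Symb × List Symb :=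
  if s = .one ∨ s = .sep then (s :: p.1, p.2)
  else ([s.inv], shiftWord n p.1.reverse ++ p.2)

/-- Read one symbol of a list of gates, and build the description of the inverse of the present gate
(reversed) on the stack `buf`. If the symbol starts a gate then the previous gate is written. -/
def invSymb (s : Symb) : Prog Reg Symb :=
  .seq (.push .inp s) (if s = .one ∨ s = .sep then .push .buf s
    else .seq (writeShifted .buf) (.push .buf s.inv))

/-- Move the gates on the stack `gates` to the stack `inp`, and write their inverses, except for the
last one, which is left on the stack `buf`. -/
def writeInverse : Prog Reg Symb := .loop .gates (fun _ => false) invSymb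

theorem length_foldl_invStep_le (n : ℕ) (o l : List Symb) :
    (l.foldl (invStep n) ([], o)).1.length ≤ l.length := by
  induction l using List.reverseRecOn with
  | nil => simp
  | append_singleton l s ih =>
    rw [List.foldl_append]
    simp only [List.foldl_cons, List.foldl_nil, invStep]
    split_ifs <;> simp [ih]

theorem runs_writeInverse {a b w L : ℕ} (ha : a ≤ L) (hb : b ≤ L) (hw : w ≤ L)
    (gates out : List Symb) (hL : gates.length ≤ L) :
    Runs writeInverse (regs a b w [] gates [] out)
      (regs a b w gates.reverse [] (gates.foldl (invStep (a + b)) ([], out)).1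
        (gates.foldl (invStep (a + b)) ([], out)).2)
      (gates.length * (1 + (L * (3 * (5 * L + 2) + 1 + 1) + 1 + 1) + 1) + 1) := by
  refine runs_loop_list (k := .gates) (l := gates) (body := invSymb)
    (fun d r => regs a b w d.reverse r (d.foldl (invStep (a + b)) ([], out)).1
      (d.foldl (invStep (a + b)) ([], out)).2) (fun _ _ => rfl) ?_
  intro d s r hd
  have hlen : (d.foldl (invStep (a + b)) ([], out)).1.length ≤ L := by
    refine (length_foldl_invStep_le _ _ _).trans (le_trans ?_ hL)
    rw [← hd]
    simp
  rw [List.foldl_append]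
  generalize d.foldl (invStep (a + b)) ([], out) = p at hlen ⊢
  refine Runs.seq (Runs.push _ _ _) ?_
  simp only [update_regs_gates, List.foldl_cons, List.foldl_nil, invStep]
  split_ifs with hs
  · refine Runs.mono (t := 1) ?_ (by omega)
    convert Runs.push Reg.buf s _ using 1
    simp [regs]
  · refine Runs.seq (Runs.mono (runs_writeShifted_buf ha hb hw (s :: d.reverse) r p.1 p.2) ?_) ?_
      |> fun h => by simpa [regs] using h
    · exact Nat.add_le_add_right (Nat.mul_le_mul_right _ hlen) 1
    · convert Runs.push Reg.buf s.inv _ using 1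
      simp [regs]

/-- What makes one-pass inversion possible: a gate and its inverse differ only in the leading
symbol, and a symbol other than `one` and `sep` always marks the start of a gate. -/
theorem Gate.encode_eq_cons {w : ℕ} (g : Gate w) : ∃ s l, g.encode = s :: l ∧
    g.inv.encode = s.inv :: l ∧ ¬(s = .one ∨ s = .sep) ∧ ∀ r ∈ l, r = .one ∨ r = .sep := by
  cases g <;> refine ⟨_, _, rfl, rfl, by simp, ?_⟩ <;> simp [encNat] <;> grind

theorem foldl_invStep_of_forall (n : ℕ) (p : List Symb × List Symb) {l : List Symb}
    (hl : ∀ r ∈ l, r = .one ∨ r = .sep) : l.foldl (invStep n) p = (l.reverse ++ p.1, p.2) := by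
  induction l generalizing p with
  | nil => rfl
  | cons s l ih =>
    rw [List.foldl_cons, ih _ fun r hr => hl r (by simp [hr])]
    simp [invStep, hl s (by simp)]

/-- Invariant of the inversion, with the gate still in the buffer counted as written. Every new gate
flushes its predecessor in front of the text so far, which reverses the order of the gates as an
inverse requires. -/
theorem foldl_invStep_gates {w : ℕ} (n : ℕ) (p : List Symb × List Symb) (l : List (Gate w)) :
    shiftWord n ((l.flatMap Gate.encode).foldl (invStep n) p).1.reverse ++
        ((l.flatMap Gate.encode).foldl (invStep n) p).2 =
      shiftWord n ((l.reverse.map Gate.inv).flatMap Gate.encode) ++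
        (shiftWord n p.1.reverse ++ p.2) := by
  induction l generalizing p with
  | nil => rfl
  | cons g l ih =>
    obtain ⟨s, u, hg, hi, hs, hu⟩ := g.encode_eq_cons
    rw [List.flatMap_cons, List.foldl_append, ih, hg, List.foldl_cons, foldl_invStep_of_forall _ _ hu]
    simp only [invStep, if_neg hs, List.reverse_append, List.reverse_reverse, List.reverse_cons,
      List.reverse_nil, List.nil_append, List.map_append, List.flatMap_append, List.map_cons,
      List.map_nil, List.flatMap_cons, List.flatMap_nil, List.append_nil, hi, shiftWord_append,
      List.append_assoc]
    rw [← List.singleton_append (l := u), shiftWord_append n [s.inv] u, List.append_assoc]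

end QCrypto

/-! ### The complete program and its polynomial running time. -/

namespace QCrypto

open StackMachine

/-- The gates that move the last flag to the output wire, as a text. -/
def outItems : List Item :=
  -- Wire `0` is written as a bare separator.
  [.lit .cnot, .lit .sep, .ctr .numIn, .ctr .numOut, .ctr .width, .lit .one, .ctr .width, .lit .sep,
    .lit .cnot, .ctr .numIn, .ctr .numOut, .ctr .width, .lit .one, .ctr .width, .lit .sep, .lit .sep]

/-- The gate that computes a flag, as a text. -/
def flagItems : List Item :=
  [.lit .tof, .ctr .numIn, .ctr .numOut, .ctr .idx, .lit .sep,
    .ctr .numIn, .ctr .numOut, .ctr .width, .lit .one, .ctr .idx, .lit .sep,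
    .ctr .numIn, .ctr .numOut, .ctr .width, .lit .one, .ctr .idx, .lit .one, .lit .sep]

/-- The gate that sets the first flag, as a text. -/
def setItems : List Item :=
  [.lit .x, .ctr .numIn, .ctr .numOut, .ctr .width, .lit .one, .lit .sep]

/-- The gate that negates a wire of the block, as a text. -/
def notItems : List Item :=
  [.lit .x, .ctr .numIn, .ctr .numOut, .ctr .idx, .lit .sep]

/-- The gate that adds an input wire to the block, as a text. -/
def copyItems : List Item :=
  [.lit .cnot, .ctr .idx, .lit .sep, .ctr .numIn, .ctr .numOut, .ctr .idx, .lit .sep]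

/-- The gates that swap a wire of the state with a wire of the block, as a text. -/
def swapItems : List Item :=
  [.lit .cnot, .ctr .numIn, .ctr .idx, .lit .sep, .ctr .numIn, .ctr .numOut, .ctr .idx, .lit .sep,
    .lit .cnot, .ctr .numIn, .ctr .numOut, .ctr .idx, .lit .sep, .ctr .numIn, .ctr .idx, .lit .sep,
    .lit .cnot, .ctr .numIn, .ctr .idx, .lit .sep, .ctr .numIn, .ctr .numOut, .ctr .idx, .lit .sep]

/-- The numbers of wires, as a text. -/
def headItems : List Item :=
  [.ctr .numIn, .ctr .numOut, .lit .sep, .lit .one, .lit .sep,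
    .ctr .numIn, .ctr .numOut, .ctr .width, .lit .one, .ctr .width, .lit .one, .lit .sep]

/-- The program that turns the description of `C` (reversed) into the description of `C.projVer`. -/
def projProg : Prog Reg Symb :=
  -- The output is produced from its end to its beginning, with the header last. `writeInverse`
  -- keeps a reversed copy of the gates on `inp`, from which the forward run of `C` is written
  -- later. The final clears leave only `out` nonempty, as a halting configuration demands.
  .seq moveInp <| .seq (readNat .numIn) <| .seq (readNat .numOut) <| .seq (readNat .width) <|
  .seq (emit outItems) <| .seq (forCtr .width flagItems) <| .seq (emit setItems) <|
  .seq (forCtr .width notItems) <| .seq (forCtr .numIn copyItems) <| .seq writeInverse <|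
  .seq (writeShifted .buf) <| .seq (forCtr .numOut swapItems) <| .seq (writeShifted .inp) <|
  .seq (forCtr .numIn copyItems) <| .seq (emit headItems) <| .seq (clear .numIn) <|
  .seq (clear .numOut) (clear .width)

/-- A bound for the running time of `emit`. -/
def emitCost {R : Type} [CommSemiring R] (L k : R) : R := k * (5 * L + 2) + 1

/-- A bound for the running time of `forCtr`. -/
def forCost {R : Type} [CommSemiring R] (L k : R) : R :=
  5 * L + 2 + (L * (k * (5 * L + 2) + 1 + 1) + 1)

/-- A bound for the running time of `projProg`. -/
def projCost {R : Type} [CommSemiring R] (L : R) : R :=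
  L * (1 + 1) + 1 + (2 * L + 1 + (2 * L + 1 + (2 * L + 1 + (emitCost L 16 + (forCost L 18 +
  (emitCost L 6 + (forCost L 5 + (forCost L 7 +
  (L * (1 + (L * (3 * (5 * L + 2) + 1 + 1) + 1 + 1) + 1) + 1 +
  (L * (3 * (5 * L + 2) + 1 + 1) + 1 + (forCost L 24 +
  (L * (3 * (5 * L + 2) + 1 + 1) + 1 + (forCost L 7 + (emitCost L 12 +
  (L * (1 + 1) + 1 + (L * (1 + 1) + 1 + (L * (1 + 1) + 1)))))))))))))))))

/-- The costs are defined over any commutative semiring, so one expression serves both as a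
polynomial in `X` and as a numerical bound. -/
theorem eval_projCost (L : ℕ) : (projCost (Polynomial.X : Polynomial ℕ)).eval L = projCost L := by
  simp [projCost, emitCost, forCost]

theorem runs_emit_regs {a b w L : ℕ} (ha : a ≤ L) (hb : b ≤ L) (hw : w ≤ L)
    (inp gates buf out : List Symb) {l : List Item} (hl : ItemsOk l) {s : List Symb}
    (hs : l.flatMap (Item.text (regs a b w inp gates buf out)) = s) :
    Runs (emit l) (regs a b w inp gates buf out) (regs a b w inp gates buf (s ++ out))
      (emitCost L l.length) := by
  convert runs_emit (good_regs inp gates buf out ha hb hw) hl using 1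
  · rw [hs]
    simp [regs]
  · simp [emitCost]

theorem runs_forCtr_regs {a b w L : ℕ} (ha : a ≤ L) (hb : b ≤ L) (hw : w ≤ L)
    (inp gates buf out : List Symb) {c : Reg} (hcm : c ∈ [Reg.numIn, .numOut, .width]) {n : ℕ}
    (hc : regs a b w inp gates buf out c = ones n) (hn : n ≤ L) {l : List Item} (hl : ItemsOk l)
    {f : ℕ → List Symb}
    (hs : ∀ i, l.flatMap (Item.text (Function.update (regs a b w inp gates buf out) .idx
      (ones i))) = f i) :
    Runs (forCtr c l) (regs a b w inp gates buf out)
      (regs a b w inp gates buf ((List.range n).flatMap f ++ out)) (forCost L l.length) := by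
  convert runs_forCtr (good_regs inp gates buf out ha hb hw) rfl hcm hc hn hl using 1
  · simp [regs, hs]
  · simp [forCost]

theorem ones_append_ones (m n : ℕ) (l : List Symb) :
    ones m ++ (ones n ++ l) = ones (m + n) ++ l := by
  rw [← List.append_assoc, ones, ones, ones, List.replicate_add]

theorem ones_append_one_cons (n : ℕ) (l : List Symb) : ones n ++ .one :: l = ones (n + 1) ++ l :=
  ones_append_ones n 1 l

theorem encNat_eq (n : ℕ) : encNat n = ones n ++ [.sep] := rfl

theorem runs_projProg {a b : ℕ} (C : QCircuit a b) :
    Runs projProg (Function.update (fun _ => []) .inp C.encode.reverse)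
      (Function.update (fun _ => []) .out C.projVer.encode)
      ((projCost (Polynomial.X : Polynomial ℕ)).eval C.encode.length) := by
  rw [eval_projCost, update_empty_inp, update_empty_out]
  set L := C.encode.length with hL
  set w := C.width with hw'
  set G := C.gates.flatMap Gate.encode with hG
  -- Numbers are written in unary, each followed by a separator; therefore `a`, `b` and `w` are
  -- bounded by the length `L` of the description.
  have hLe : L = a + 1 + (b + 1) + (w + 1) + G.length := by
    simp [hL, QCircuit.encode, encNat, hG, hw']
    omega
  have ha : a ≤ L := by omega
  have hb : b ≤ L := by omega
  have hw : w ≤ L := by omega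
  have hGL : G.length ≤ L := by omega
  refine Runs.seq (runs_moveInp _) ?_
  rw [show C.encode = encNat a ++ (encNat b ++ (encNat w ++ G)) by simp [QCircuit.encode, hG, hw']]
  have haa : Runs (readNat .numIn) (regs 0 0 0 [] (encNat a ++ (encNat b ++ (encNat w ++ G))) [] [])
      (regs a 0 0 [] (encNat b ++ (encNat w ++ G)) [] []) (2 * L + 1) := by
    refine Runs.mono (t := 2 * a + 1) ?_ (by omega)
    convert runs_readNat (c := .numIn) (by simp) a
      (S := regs 0 0 0 [] (encNat a ++ (encNat b ++ (encNat w ++ G))) [] []) rfl using 1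
    simp [regs]
  refine Runs.seq haa ?_
  have hbb : Runs (readNat .numOut) (regs a 0 0 [] (encNat b ++ (encNat w ++ G)) [] [])
      (regs a b 0 [] (encNat w ++ G) [] []) (2 * L + 1) := by
    refine Runs.mono (t := 2 * b + 1) ?_ (by omega)
    convert runs_readNat (c := .numOut) (by simp) b
      (S := regs a 0 0 [] (encNat b ++ (encNat w ++ G)) [] []) rfl using 1
    simp [regs]
  refine Runs.seq hbb ?_
  have hww : Runs (readNat .width) (regs a b 0 [] (encNat w ++ G) [] [])
      (regs a b w [] G [] []) (2 * L + 1) := by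
    refine Runs.mono (t := 2 * w + 1) ?_ (by omega)
    convert runs_readNat (c := .width) (by simp) w
      (S := regs a b 0 [] (encNat w ++ G) [] []) rfl using 1
    simp [regs]
  refine Runs.seq hww ?_
  refine Runs.seq (runs_emit_regs ha hb hw _ _ _ _ (by simp [ItemsOk, outItems]) rfl) ?_
  refine Runs.seq (runs_forCtr_regs ha hb hw _ _ _ _ (by simp) rfl hw
    (by simp [ItemsOk, flagItems]) (fun i => rfl)) ?_
  refine Runs.seq (runs_emit_regs ha hb hw _ _ _ _ (by simp [ItemsOk, setItems]) rfl) ?_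
  refine Runs.seq (runs_forCtr_regs ha hb hw _ _ _ _ (by simp) rfl hw
    (by simp [ItemsOk, notItems]) (fun i => rfl)) ?_
  refine Runs.seq (runs_forCtr_regs ha hb hw _ _ _ _ (by simp) rfl ha
    (by simp [ItemsOk, copyItems]) (fun i => rfl)) ?_
  refine Runs.seq ((runs_writeInverse ha hb hw G _ hGL).mono
    (Nat.add_le_add_right (Nat.mul_le_mul_right _ hGL) 1)) ?_
  refine Runs.seq ((runs_writeShifted_buf ha hb hw _ _ _ _).mono
    (Nat.add_le_add_right (Nat.mul_le_mul_right _
      ((length_foldl_invStep_le _ _ _).trans hGL)) 1)) ?_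
  -- The flush of the buffer writes the one gate that the inversion had left there, so that the
  -- inverse list is now complete.
  rw [hG, foldl_invStep_gates, ← hG]
  refine Runs.seq (runs_forCtr_regs ha hb hw _ _ _ _ (by simp) rfl hb
    (by simp [ItemsOk, swapItems]) (fun i => rfl)) ?_
  refine Runs.seq ((runs_writeShifted_inp ha hb hw _ _ _ _).mono
    (Nat.add_le_add_right (Nat.mul_le_mul_right _ (by simpa using hGL)) 1)) ?_
  refine Runs.seq (runs_forCtr_regs ha hb hw _ _ _ _ (by simp) rfl ha
    (by simp [ItemsOk, copyItems]) (fun i => rfl)) ?_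
  refine Runs.seq (runs_emit_regs ha hb hw _ _ _ _ (by simp [ItemsOk, headItems]) rfl) ?_
  refine Runs.seq ((runs_clear (n := a) rfl).mono (Nat.add_le_add_right (Nat.mul_le_mul_right _ ha) 1)) ?_
  rw [update_regs_numIn]
  refine Runs.seq ((runs_clear (n := b) rfl).mono (Nat.add_le_add_right (Nat.mul_le_mul_right _ hb) 1)) ?_
  rw [update_regs_numOut]
  refine Runs.mono ?_ (Nat.add_le_add_right (Nat.mul_le_mul_right _ hw) 1)
  convert runs_clear (n := w) ?_ using 1
  rotate_left
  · rfl
  rw [update_regs_width]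
  congr 1
  rw [QCircuit.encode_projVer]
  simp only [outItems, flagItems, setItems, notItems, copyItems, swapItems, headItems,
    List.flatMap_cons, List.flatMap_nil, Item.text, List.append_nil, List.append_assoc, regs,
    Function.update_self, List.reverse_nil, ← hG, ← hw', List.reverse_reverse,
    List.cons_append, List.nil_append, ones_append_ones, ones_append_one_cons, ne_eq, reduceCtorEq,
    not_false_eq_true, Function.update_of_ne, encNat_eq]
  simp only [add_assoc, show shiftWord (a + b) [] = [] from rfl, List.nil_append]
  rfl

/-- The verification by projection is a uniform family of circuits if the state generation is. -/
theorem isQPT_projVer {a b : ℕ → ℕ} {C : ∀ n, QCircuit (a n) (b n)} (hC : IsQPT C) :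
    IsQPT fun n => (C n).projVer := by
  obtain ⟨h⟩ := hC
  -- The descriptions are regarded as an output encoding of `n` itself. The same machine then
  -- computes `id`, and the composition lemma applies with both functions equal to `id`.
  have h' : Turing.TM2ComputableInPolyTime Computability.unaryEncodeNat
      (fun n => (C n).encode) (id : ℕ → ℕ) :=
    ⟨h.toTM2ComputableAux, h.time, h.outputsFun⟩
  obtain ⟨h''⟩ := nonempty_computableInPolyTime_comp (ec := fun n => (C n).projVer.encode)
    (g := id) h' projProg .inp .out _ fun n => runs_projProg (C n)
  exact ⟨⟨h''.toTM2ComputableAux, h''.time, h''.outputsFun⟩⟩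

end QCrypto

namespace QCrypto

open Matrix

/-! ### Matrices of gates -/

section BasisMap

variable {w : ℕ}

theorem basisMap_mul_apply {ι : Type*} {f : Bits w → Bits w} (hf : f.Injective)
    (A : Matrix (Bits w) ι ℂ) (x : Bits w) (z : ι) : (basisMap f * A) (f x) z = A x z := by
  rw [mul_apply, Finset.sum_eq_single x]
  · simp [basisMap]
  · intro y _ hy
    simp [basisMap, hf.eq_iff, Ne.symm hy]
  · simp

theorem mul_basisMap_apply (A : Op w) (f : Bits w → Bits w) (x z : Bits w) :
    (A * basisMap f) x z = A x (f z) := by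
  rw [mul_apply, Finset.sum_eq_single (f z)]
  · simp [basisMap]
  · intro y _ hy
    simp [basisMap, hy]
  · simp

theorem basisMap_mul_basisMap (f g : Bits w → Bits w) :
    basisMap f * basisMap g = basisMap (f ∘ g) := by
  ext x z
  rw [mul_basisMap_apply]
  rfl

theorem basisMap_id : basisMap (id : Bits w → Bits w) = 1 := by
  ext x z
  simp [basisMap, one_apply]

theorem conjTranspose_basisMap {f : Bits w → Bits w} (hf : f.Involutive) :
    (basisMap f)ᴴ = basisMap f := by
  ext x z
  have : z = f x ↔ x = f z := by rw [eq_comm, hf.eq_iff, eq_comm]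
  simp only [conjTranspose_apply, basisMap, this]
  split_ifs <;> simp

end BasisMap

/-! ### Operators on a selection of wires. -/

section Lift

variable {w v : ℕ}

/-- The operator `M` acting on the qubits selected by `e` (and trivially on the others). -/
noncomputable def lift (e : Fin w ↪ Fin v) (M : Op w) : Op v :=
  fun x y => if ∀ j, j ∉ Set.range e → x j = y j then M (x ∘ e) (y ∘ e) else 0

/-- The string `x` with the bits selected by `e` replaced. -/
noncomputable def replaceBits (e : Fin w ↪ Fin v) (b : Bits w) (x : Bits v) : Bits v := Function.extend e b x

@[simp]
theorem replaceBits_apply (e : Fin w ↪ Fin v) (b : Bits w) (x : Bits v) (i : Fin w) :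
    replaceBits e b x (e i) = b i := e.injective.extend_apply _ _ _

theorem replaceBits_of_notMem (e : Fin w ↪ Fin v) (b : Bits w) (x : Bits v) {j : Fin v}
    (hj : j ∉ Set.range e) : replaceBits e b x j = x j :=
  Function.extend_apply' _ _ _ hj

theorem replaceBits_comp (e : Fin w ↪ Fin v) (b : Bits w) (x : Bits v) :
    replaceBits e b x ∘ e = b := by
  funext i
  simp

theorem replaceBits_self (e : Fin w ↪ Fin v) {x y : Bits v}
    (h : ∀ j, j ∉ Set.range e → x j = y j) : replaceBits e (y ∘ e) x = y := by
  funext j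
  by_cases hj : j ∈ Set.range e
  · obtain ⟨i, rfl⟩ := hj; simp
  · rw [replaceBits_of_notMem e _ _ hj, h j hj]

/-- Strings that agree with `x` off the range of `e` are parametrized by their bits on that range.
-/
theorem sum_ite_agree {A : Type*} [AddCommMonoid A] (e : Fin w ↪ Fin v) (x : Bits v)
    (f : Bits v → A) :
    (∑ y, if ∀ j, j ∉ Set.range e → x j = y j then f y else 0) =
      ∑ b : Bits w, f (replaceBits e b x) := by
  classical
  rw [← Finset.sum_filter]
  refine Finset.sum_nbij' (fun y => y ∘ e) (fun b => replaceBits e b x) (by simp) ?_ ?_ ?_ ?_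
  · intro b _
    simp only [Finset.mem_filter, Finset.mem_univ, true_and]
    intro j hj
    rw [replaceBits_of_notMem e _ _ hj]
  · intro y hy
    exact replaceBits_self e (by simpa using hy)
  · intro b _
    exact replaceBits_comp e b x
  · intro y hy
    simp only [Finset.mem_filter, Finset.mem_univ, true_and] at hy
    rw [replaceBits_self e hy]

theorem lift_mul_apply {ι : Type*} (e : Fin w ↪ Fin v) (M : Op w) (A : Matrix (Bits v) ι ℂ)
    (x : Bits v) (z : ι) :
    (lift e M * A) x z = ∑ b, M (x ∘ e) b * A (replaceBits e b x) z := by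
  simp only [mul_apply, lift, ite_mul, zero_mul]
  rw [sum_ite_agree e x fun y => M (x ∘ e) (y ∘ e) * A y z]
  simp only [replaceBits_comp]

theorem lift_mul (e : Fin w ↪ Fin v) (M N : Op w) : lift e (M * N) = lift e M * lift e N := by
  ext x z
  rw [lift_mul_apply]
  have h : ∀ b, (∀ j, j ∉ Set.range e → replaceBits e b x j = z j) ↔
      ∀ j, j ∉ Set.range e → x j = z j := fun b =>
    forall₂_congr fun j hj => by rw [replaceBits_of_notMem e b x hj]
  simp only [lift, h, replaceBits_comp, mul_apply]
  split_ifs <;> simp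

theorem lift_basisMap (e : Fin w ↪ Fin v) (f : Bits w → Bits w) :
    lift e (basisMap f) = basisMap fun y => replaceBits e (f (y ∘ e)) y := by
  ext x y
  simp only [lift, basisMap]
  have : x = replaceBits e (f (y ∘ e)) y ↔
      (∀ j, j ∉ Set.range e → x j = y j) ∧ x ∘ e = f (y ∘ e) := by
    constructor
    · intro h
      exact ⟨fun j hj => by rw [h, replaceBits_of_notMem e _ _ hj], by rw [h, replaceBits_comp]⟩
    · rintro ⟨h, h'⟩
      rw [← h']
      exact (replaceBits_self e fun j hj => (h j hj).symm).symm
  rw [if_congr this rfl rfl, ite_and]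

theorem lift_one (e : Fin w ↪ Fin v) : lift e (1 : Op w) = 1 := by
  rw [← basisMap_id, lift_basisMap, ← basisMap_id]
  congr 1
  funext y
  exact replaceBits_self e fun _ _ => rfl

theorem update_eq_replaceBits (e : Fin w ↪ Fin v) (y : Bits v) (a : Fin w) (s : Bool) :
    Function.update y (e a) s = replaceBits e (Function.update (y ∘ e) a s) y := by
  funext j
  by_cases hj : j ∈ Set.range e
  · obtain ⟨i, rfl⟩ := hj
    simp [Function.update_apply]
  · rw [replaceBits_of_notMem e _ _ hj, Function.update_of_ne]
    rintro rfl
    exact hj ⟨a, rfl⟩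

theorem lift_onQubit (e : Fin w ↪ Fin v) (a : Fin w) (u : Bool → Bool → ℂ) :
    lift e (onQubit a u) = onQubit (e a) u := by
  ext x y
  simp only [lift, onQubit, Function.comp_apply]
  have : (∀ j, j ≠ e a → x j = y j) ↔
      (∀ j, j ∉ Set.range e → x j = y j) ∧ ∀ j, j ≠ a → x (e j) = y (e j) := by
    constructor
    · intro h
      exact ⟨fun j hj => h j (by rintro rfl; exact hj ⟨a, rfl⟩), fun j hj => h _ (by simpa using hj)⟩
    · rintro ⟨h, h'⟩ j hj
      by_cases hj' : j ∈ Set.range e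
      · obtain ⟨i, rfl⟩ := hj'
        exact h' i (by simpa using hj)
      · exact h j hj'
  simp only [this]
  split_ifs <;> simp_all

theorem Gate.mat_map (e : Fin w ↪ Fin v) (g : Gate w) : (g.map e).mat = lift e g.mat := by
  cases g <;> simp [Gate.map, Gate.mat, lift_onQubit, lift_basisMap, update_eq_replaceBits]

end Lift

/-! ### Unitarity and inverses of gate lists. -/

section Unitary

variable {w : ℕ}

/-- The wire `a`, as a choice of one wire. -/
def oneWire (a : Fin w) : Fin 1 ↪ Fin w := ⟨fun _ => a, fun _ _ _ => Subsingleton.elim _ _⟩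

/-- Reduces products of one-qubit operators to width one, where the sum has just two terms. -/
theorem onQubit_eq_lift (a : Fin w) (u : Bool → Bool → ℂ) :
    onQubit a u = lift (oneWire a) (onQubit 0 u) := (lift_onQubit (oneWire a) 0 u).symm

theorem onQubit_mul_onQubit (a : Fin w) (u v : Bool → Bool → ℂ) :
    onQubit a u * onQubit a v = onQubit a fun i j => u i false * v false j + u i true * v true j := by
  rw [onQubit_eq_lift a u, onQubit_eq_lift a v, onQubit_eq_lift a fun i j => _, ← lift_mul]
  congr 1
  ext x y
  rw [mul_apply, ← (Equiv.funUnique (Fin 1) Bool).symm.sum_comp]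
  simp [onQubit, add_comm]

theorem conjTranspose_onQubit (a : Fin w) (u : Bool → Bool → ℂ) :
    (onQubit a u)ᴴ = onQubit a fun i j => star (u j i) := by
  ext x y
  have : (∀ j, j ≠ a → x j = y j) ↔ ∀ j, j ≠ a → y j = x j :=
    forall₂_congr fun j hj => eq_comm
  simp only [conjTranspose_apply, onQubit, this]
  split_ifs <;> simp

theorem onQubit_one (a : Fin w) : onQubit a (fun i j => if i = j then 1 else 0) = 1 := by
  ext x y
  simp only [onQubit, one_apply]
  have : x = y ↔ (∀ j, j ≠ a → x j = y j) ∧ x a = y a := by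
    constructor
    · rintro rfl; simp
    · rintro ⟨h, h'⟩
      funext j
      by_cases hj : j = a
      · rw [hj, h']
      · exact h j hj
  simp only [this]
  split_ifs <;> simp_all

/-- The action of a gate on the computational basis, for the gates that permute the basis. -/
def Gate.act : Gate w → Bits w → Bits w
  | .x a, y => Function.update y a (!(y a))
  | .cnot c a _, y => Function.update y a (xor (y a) (y c))
  | .tof c d a _ _ _, y => Function.update y a (xor (y a) (y c && y d))
  -- With this default for the remaining gates, `Gate.act` is an involution for every gate, without
  -- a condition on its kind.
  | _, y => y

/-- The gate permutes the computational basis. -/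
def Gate.IsClassical : Gate w → Prop
  | .x _ => True
  | .cnot _ _ _ => True
  | .tof _ _ _ _ _ _ => True
  | _ => False

theorem Gate.involutive_act (g : Gate w) : g.act.Involutive := by
  intro y
  cases g with
  | x a => simp [Gate.act]
  | cnot c a h => simp [Gate.act, Function.update_of_ne h]
  | tof c d a h h' h'' =>
    simp [Gate.act, Function.update_of_ne h', Function.update_of_ne h'']
  | _ => rfl

theorem Gate.mat_of_isClassical {g : Gate w} (hg : g.IsClassical) : g.mat = basisMap g.act := by
  cases g <;> first | rfl | exact hg.elim

theorem Gate.mat_inv (g : Gate w) : g.inv.mat = g.matᴴ := by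
  cases g with
  | x a => exact (conjTranspose_basisMap (Gate.x a).involutive_act).symm
  | cnot c a h => exact (conjTranspose_basisMap (Gate.cnot c a h).involutive_act).symm
  | tof c d a h h' h'' => exact (conjTranspose_basisMap (Gate.tof c d a h h' h'').involutive_act).symm
  | h a =>
    simp only [Gate.inv, Gate.mat, conjTranspose_onQubit]
    congr 1
    funext i j
    cases i <;> cases j <;> simp
  | t a =>
    simp only [Gate.inv, Gate.mat, conjTranspose_onQubit]
    congr 1
    funext i j
    cases i <;> cases j <;> simp [← Complex.exp_conj, Complex.conj_ofNat]
  | tdg a =>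
    simp only [Gate.inv, Gate.mat, conjTranspose_onQubit]
    congr 1
    funext i j
    cases i <;> cases j <;> simp [← Complex.exp_conj, Complex.conj_ofNat]

theorem Gate.conjTranspose_mat_mul_mat (g : Gate w) : g.matᴴ * g.mat = 1 := by
  have hcl : ∀ g : Gate w, g.IsClassical → g.matᴴ * g.mat = 1 := by
    intro g hg
    rw [Gate.mat_of_isClassical hg, conjTranspose_basisMap g.involutive_act, basisMap_mul_basisMap,
      g.involutive_act.comp_self, basisMap_id]
  cases g with
  | x a => exact hcl _ trivial
  | cnot c a h => exact hcl _ trivial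
  | tof c d a h h' h'' => exact hcl _ trivial
  | h a =>
    simp only [Gate.mat, conjTranspose_onQubit, onQubit_mul_onQubit]
    rw [← onQubit_one a]
    congr 1
    funext i j
    have h2 : ((Real.sqrt 2 : ℝ) : ℂ)⁻¹ * ((Real.sqrt 2 : ℝ) : ℂ)⁻¹ = 1 / 2 := by
      rw [← mul_inv, ← Complex.ofReal_mul, Real.mul_self_sqrt (by norm_num)]
      norm_num
    cases i <;> cases j <;> simp [div_eq_mul_inv, h2] <;> norm_num
  | t a =>
    simp only [Gate.mat, conjTranspose_onQubit, onQubit_mul_onQubit]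
    rw [← onQubit_one a]
    congr 1
    funext i j
    cases i <;> cases j <;> simp [← Complex.exp_conj, Complex.conj_ofNat, ← Complex.exp_add]
  | tdg a =>
    simp only [Gate.mat, conjTranspose_onQubit, onQubit_mul_onQubit]
    rw [← onQubit_one a]
    congr 1
    funext i j
    cases i <;> cases j <;> simp [← Complex.exp_conj, Complex.conj_ofNat, ← Complex.exp_add]

/-- The unitary matrix of a list of gates. -/
noncomputable def gatesMat (l : List (Gate w)) : Op w := l.foldl (fun U g => g.mat * U) 1

theorem foldl_mat (l : List (Gate w)) (M : Op w) :
    l.foldl (fun U g => g.mat * U) M = gatesMat l * M := by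
  induction l generalizing M with
  | nil => simp [gatesMat]
  | cons g l ih =>
    rw [gatesMat, List.foldl_cons, List.foldl_cons, ih, ih, mul_one, Matrix.mul_assoc]

theorem gatesMat_append (l l' : List (Gate w)) : gatesMat (l ++ l') = gatesMat l' * gatesMat l := by
  rw [gatesMat, List.foldl_append, foldl_mat l']
  rfl

theorem gatesMat_singleton (g : Gate w) : gatesMat [g] = g.mat := by simp [gatesMat]

theorem gatesMat_cons (g : Gate w) (l : List (Gate w)) : gatesMat (g :: l) = gatesMat l * g.mat := by
  rw [← List.singleton_append, gatesMat_append, gatesMat_singleton]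

theorem gatesMat_map {v : ℕ} (e : Fin w ↪ Fin v) (l : List (Gate w)) :
    gatesMat (l.map (Gate.map e)) = lift e (gatesMat l) := by
  induction l with
  | nil => exact (lift_one e).symm
  | cons g l ih => rw [List.map_cons, gatesMat_cons, gatesMat_cons, lift_mul, ih, Gate.mat_map]

theorem gatesMat_reverse_map_inv (l : List (Gate w)) :
    gatesMat (l.reverse.map Gate.inv) = (gatesMat l)ᴴ := by
  induction l with
  | nil => simp [gatesMat]
  | cons g l ih =>
    rw [List.reverse_cons, List.map_append, gatesMat_append, ih, gatesMat_cons,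
      conjTranspose_mul, List.map_singleton, gatesMat_singleton, Gate.mat_inv]

theorem conjTranspose_gatesMat_mul_gatesMat (l : List (Gate w)) :
    (gatesMat l)ᴴ * gatesMat l = 1 := by
  induction l with
  | nil => simp [gatesMat]
  | cons g l ih =>
    rw [gatesMat_cons, conjTranspose_mul, Matrix.mul_assoc, ← Matrix.mul_assoc _ _ g.mat, ih,
      Matrix.one_mul, g.conjTranspose_mat_mul_mat]

/-- The action of a list of gates on the computational basis. -/
def gatesAct (l : List (Gate w)) (y : Bits w) : Bits w := l.foldl (fun y g => g.act y) y

theorem gatesAct_append (l l' : List (Gate w)) (y : Bits w) :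
    gatesAct (l ++ l') y = gatesAct l' (gatesAct l y) := by
  simp [gatesAct]

theorem gatesAct_cons (g : Gate w) (l : List (Gate w)) (y : Bits w) :
    gatesAct (g :: l) y = gatesAct l (g.act y) := rfl

theorem injective_gatesAct (l : List (Gate w)) : (gatesAct l).Injective := by
  induction l with
  | nil => exact fun _ _ h => h
  | cons g l ih => exact ih.comp g.involutive_act.injective

theorem gatesMat_of_isClassical {l : List (Gate w)} (hl : ∀ g ∈ l, g.IsClassical) :
    gatesMat l = basisMap (gatesAct l) := by
  induction l with
  | nil => exact basisMap_id.symm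
  | cons g l ih =>
    rw [gatesMat_cons, ih fun g hg => hl g (by simp [hg]), Gate.mat_of_isClassical (hl g (by simp)),
      basisMap_mul_basisMap]
    rfl

end Unitary

end QCrypto

namespace QCrypto

open Matrix

/-! ### Outcome probabilities of circuits -/

section Embed

variable {ι m : Type*}

/-- A matrix `ρ`, with its indices embedded into a larger type. -/
theorem eq_embed [Fintype ι] [DecidableEq ι] [DecidableEq m] {f : ι → m} (hf : f.Injective) (ρ : Matrix ι ι ℂ) (M : Matrix m m ℂ)
    (h₁ : ∀ u v, M (f u) (f v) = ρ u v) (h₂ : ∀ x y, x ∉ Set.range f ∨ y ∉ Set.range f → M x y = 0) :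
    M = (1 : Matrix m m ℂ).submatrix id f * ρ * ((1 : Matrix m m ℂ).submatrix id f)ᴴ := by
  ext x y
  simp only [mul_apply, submatrix_apply, conjTranspose_apply, id, one_apply]
  by_cases hx : x ∈ Set.range f
  · obtain ⟨u, rfl⟩ := hx
    by_cases hy : y ∈ Set.range f
    · obtain ⟨v, rfl⟩ := hy
      simp [hf.eq_iff, h₁]
    · rw [h₂ _ _ (Or.inr hy), Finset.sum_eq_zero]
      intro v _
      rw [if_neg (by rintro rfl; exact hy ⟨v, rfl⟩)]
      simp
  · rw [h₂ _ _ (Or.inl hx), Finset.sum_eq_zero]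
    intro v _
    rw [Finset.sum_eq_zero, zero_mul]
    intro u _
    rw [if_neg (by rintro rfl; exact hx ⟨u, rfl⟩), zero_mul]

/-- Adjoining ancillas or a classical input is conjugation by columns of the identity. A circuit
applied afterwards is thus conjugation by a selection of columns of its unitary. -/
theorem mul_embed_mul [Fintype ι] [Fintype m] [DecidableEq m] {ι' : Type*} (U : Matrix ι' m ℂ) (f : ι → m) (ρ : Matrix ι ι ℂ) :
    U * ((1 : Matrix m m ℂ).submatrix id f * ρ * ((1 : Matrix m m ℂ).submatrix id f)ᴴ) * Uᴴ =
      U.submatrix id f * ρ * (U.submatrix id f)ᴴ := by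
  have : U.submatrix id f = U * (1 : Matrix m m ℂ).submatrix id f := by
    ext x y
    simp [mul_apply, one_apply]
  rw [this, conjTranspose_mul]
  simp only [Matrix.mul_assoc]

theorem conjTranspose_submatrix_mul_submatrix [DecidableEq ι] [DecidableEq m] {ι' : Type*}
    [Fintype ι'] {U : Matrix ι' m ℂ}
    (hU : Uᴴ * U = 1) {f : ι → m} (hf : f.Injective) :
    (U.submatrix id f)ᴴ * U.submatrix id f = 1 := by
  have : (U.submatrix id f)ᴴ * U.submatrix id f = (Uᴴ * U).submatrix f f := by
    ext x y
    simp [mul_apply]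
  rw [this, hU]
  ext x y
  simp [one_apply, hf.eq_iff]

end Embed

/-- The bit string `x`, followed by zeros. -/
def padBits {a w : ℕ} (x : Bits a) : Bits w := fun j => if h : j.val < a then x ⟨j, h⟩ else false

theorem padBits_castLE {a w : ℕ} (h : a ≤ w) (x : Bits a) (i : Fin a) :
    (padBits x : Bits w) (Fin.castLE h i) = x i := by
  simp [padBits]

theorem injective_padBits {a w : ℕ} (h : a ≤ w) :
    (padBits : Bits a → Bits w).Injective := by
  intro x y hxy
  funext i
  rw [← padBits_castLE h x, hxy, padBits_castLE h]

theorem padZero_eq {a w : ℕ} (h : a ≤ w) (ρ : Op a) :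
    padZero h ρ = (1 : Op w).submatrix id (padBits (a := a)) * ρ *
      ((1 : Op w).submatrix id (padBits (a := a)))ᴴ := by
  have hr : ∀ x : Bits w, (∀ j : Fin w, a ≤ j.val → x j = false) → x ∈ Set.range (padBits (a := a)) := by
    intro x hx
    refine ⟨fun i => x (Fin.castLE h i), ?_⟩
    funext j
    simp only [padBits]
    split_ifs with hj
    · rfl
    · rw [hx j (by omega)]
  have hp : ∀ (x : Bits a) (j : Fin w), a ≤ j.val → (padBits x : Bits w) j = false := by
    intro x j hj
    simp [padBits, hj]
  refine eq_embed (injective_padBits h) ρ _ ?_ ?_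
  · intro u v
    rw [padZero, if_pos ⟨hp u, hp v⟩]
    simp only [padBits_castLE]
  · rintro x y hxy
    rw [padZero, if_neg]
    rintro ⟨h₁, h₂⟩
    exact hxy.elim (fun h => h (hr x h₁)) fun h => h (hr y h₂)

theorem injective_append {a b : ℕ} (k : Bits a) :
    (Fin.append k : Bits b → Bits (a + b)).Injective := by
  intro u v h
  funext i
  have := congrFun h (Fin.natAdd a i)
  simpa using this

theorem tensor_classical_eq {a b : ℕ} (k : Bits a) (ρ : Op b) :
    tensor (classical k) ρ = (1 : Op (a + b)).submatrix id (Fin.append k) * ρ *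
      ((1 : Op (a + b)).submatrix id (Fin.append k))ᴴ := by
  refine eq_embed (injective_append k) ρ _ ?_ ?_
  · intro u v
    simp [tensor, classical]
  · intro x y hxy
    have hr : ∀ x : Bits (a + b), k = (fun i => x (Fin.castAdd b i)) →
        x ∈ Set.range (Fin.append k : Bits b → Bits (a + b)) := by
      intro x hx
      refine ⟨fun i => x (Fin.natAdd a i), ?_⟩
      rw [hx]
      exact Fin.append_castAdd_natAdd
    simp only [tensor, classical, single_apply]
    rw [if_neg, zero_mul]
    rintro ⟨h₁, h₂⟩
    exact hxy.elim (fun h => h (hr x h₁)) fun h => h (hr y h₂)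

/-- The isometry implemented by a circuit, before qubits are discarded. -/
noncomputable def QCircuit.isom {a b : ℕ} (C : QCircuit a b) : Matrix (Bits C.width) (Bits a) ℂ :=
  C.unitary.submatrix id padBits

theorem QCircuit.conjTranspose_isom_mul_isom {a b : ℕ} (C : QCircuit a b) :
    C.isomᴴ * C.isom = 1 :=
  conjTranspose_submatrix_mul_submatrix (conjTranspose_gatesMat_mul_gatesMat C.gates)
    (injective_padBits C.nin_le)

/-- On the diagonal both indices of the partial trace start with `o` and agree on the remaining
bits, so only equal indices contribute. -/
theorem outcomeProb_traceRest {b w : ℕ} (h : b ≤ w) (M : Op w) (o : Bits b) :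
    outcomeProb (traceRest h M) o =
      ∑ x, if ∀ i, x (Fin.castLE h i) = o i then (M x x).re else 0 := by
  rw [outcomeProb, traceRest, Complex.re_sum]
  refine Finset.sum_congr rfl fun x _ => ?_
  rw [Finset.sum_eq_single x]
  · simp only [implies_true, and_true, and_self]
    split_ifs <;> rfl
  · rintro y - hy
    rw [if_neg]
    rintro ⟨h₁, h₂, h₃⟩
    refine hy (funext fun j => ?_)
    by_cases hj : j.val < b
    · have h₁ := h₁ ⟨j, hj⟩
      have h₂ := h₂ ⟨j, hj⟩
      exact h₂.trans h₁.symm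
    · exact (h₃ j (by omega)).symm
  · simp

theorem outcomeProb_run {a b : ℕ} (C : QCircuit a b) (ρ : Op a) (o : Bits b) :
    outcomeProb (C.run ρ) o = ∑ x, if ∀ i, x (Fin.castLE C.nout_le i) = o i then
      ((C.isom * ρ * C.isomᴴ) x x).re else 0 := by
  rw [QCircuit.run, outcomeProb_traceRest, padZero_eq, mul_embed_mul]
  rfl

/-- The isometry implemented by a circuit whose first input is a classical string. -/
noncomputable def QCircuit.isomAt {a b c : ℕ} (C : QCircuit (a + b) c) (k : Bits a) :
    Matrix (Bits C.width) (Bits b) ℂ :=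
  C.isom.submatrix id (Fin.append k)

theorem QCircuit.conjTranspose_isomAt_mul_isomAt {a b c : ℕ} (C : QCircuit (a + b) c)
    (k : Bits a) : (C.isomAt k)ᴴ * C.isomAt k = 1 :=
  conjTranspose_submatrix_mul_submatrix C.conjTranspose_isom_mul_isom (injective_append k)

theorem outcomeProb_run_tensor {a b c : ℕ} (C : QCircuit (a + b) c) (k : Bits a) (ρ : Op b)
    (o : Bits c) :
    outcomeProb (C.run (tensor (classical k) ρ)) o =
      ∑ x, if ∀ i, x (Fin.castLE C.nout_le i) = o i then
        ((C.isomAt k * ρ * (C.isomAt k)ᴴ) x x).re else 0 := by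
  rw [outcomeProb_run, tensor_classical_eq, mul_embed_mul]
  rfl

/-! ### Pure states -/

section Pure

variable {n : ℕ}

theorem mul_pureOp_mul {m : Type*} (T : Matrix m (Bits n) ℂ) (ψ : Bits n → ℂ) (x : m) :
    ((T * pureOp ψ * Tᴴ) x x).re = ‖(T *ᵥ ψ) x‖ ^ 2 := by
  rw [pureOp, mul_vecMulVec, vecMulVec_mul, ← star_mulVec, vecMulVec_apply, Pi.star_apply,
    ← starRingEnd_apply, Complex.mul_conj, Complex.ofReal_re, Complex.normSq_eq_norm_sq]

theorem braket_self (ψ : Bits n → ℂ) : braket ψ ψ = ((∑ x, ‖ψ x‖ ^ 2 : ℝ) : ℂ) := by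
  simp only [braket, dotProduct, Pi.star_apply, Complex.ofReal_sum]
  refine Finset.sum_congr rfl fun x _ => ?_
  rw [mul_comm, ← starRingEnd_apply, Complex.mul_conj, Complex.normSq_eq_norm_sq]

theorem braket_self_eq_one_iff (ψ : Bits n → ℂ) : braket ψ ψ = 1 ↔ ∑ x, ‖ψ x‖ ^ 2 = 1 := by
  rw [braket_self]
  exact_mod_cast Iff.rfl

theorem star_mulVec_dotProduct {m : Type*} [Fintype m] {T : Matrix m (Bits n) ℂ} (hT : Tᴴ * T = 1)
    (χ ψ : Bits n → ℂ) : star (T *ᵥ χ) ⬝ᵥ T *ᵥ ψ = braket χ ψ := by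
  rw [star_mulVec, dotProduct_mulVec, vecMul_vecMul, hT, vecMul_one, braket]

theorem sum_norm_mulVec {m : Type*} [Fintype m] {T : Matrix m (Bits n) ℂ} (hT : Tᴴ * T = 1)
    (ψ : Bits n → ℂ) : ∑ x, ‖(T *ᵥ ψ) x‖ ^ 2 = ∑ x, ‖ψ x‖ ^ 2 := by
  have h := star_mulVec_dotProduct hT ψ ψ
  rw [braket_self, dotProduct] at h
  have : ∀ x, star (T *ᵥ ψ) x * (T *ᵥ ψ) x = ((‖(T *ᵥ ψ) x‖ ^ 2 : ℝ) : ℂ) := by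
    intro x
    rw [Pi.star_apply, mul_comm, ← starRingEnd_apply, Complex.mul_conj, Complex.normSq_eq_norm_sq]
  simp only [this] at h
  exact_mod_cast h

theorem outcomeProb_run_pureOp {a b : ℕ} (C : QCircuit a b) (ψ : Bits a → ℂ) (o : Bits b) :
    outcomeProb (C.run (pureOp ψ)) o =
      ∑ x, if ∀ i, x (Fin.castLE C.nout_le i) = o i then ‖(C.isom *ᵥ ψ) x‖ ^ 2 else 0 := by
  simp only [outcomeProb_run, mul_pureOp_mul]

theorem outcomeProb_run_pureOp_nonneg {a b : ℕ} (C : QCircuit a b) (ψ : Bits a → ℂ) (o : Bits b) :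
    0 ≤ outcomeProb (C.run (pureOp ψ)) o := by
  rw [outcomeProb_run_pureOp]
  exact Finset.sum_nonneg fun x _ => by split_ifs <;> positivity

theorem sum_outcomeProb_run_pureOp {a b : ℕ} (C : QCircuit a b) {ψ : Bits a → ℂ}
    (hψ : ∑ x, ‖ψ x‖ ^ 2 = 1) : ∑ o, outcomeProb (C.run (pureOp ψ)) o = 1 := by
  simp only [outcomeProb_run_pureOp]
  rw [Finset.sum_comm, ← hψ, ← sum_norm_mulVec C.conjTranspose_isom_mul_isom]
  refine Finset.sum_congr rfl fun x _ => ?_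
  rw [Finset.sum_eq_single fun i => x (Fin.castLE C.nout_le i)]
  · simp
  · intro o _ ho
    rw [if_neg fun h => ho (funext fun i => (h i).symm)]
  · simp

theorem one_eq_pureOp : (1 : Op 0) = pureOp fun _ => 1 := by
  ext x y
  simp [pureOp, vecMulVec_apply, one_apply, Subsingleton.elim x y]

theorem copies_pureOp (t : ℕ) (ψ : Bits n → ℂ) :
    copies t (pureOp ψ) = pureOp fun x => ∏ i : Fin t, ψ fun j => x (finProdFinEquiv (i, j)) := by
  ext x y
  simp [copies, pureOp, vecMulVec_apply, Finset.prod_mul_distrib]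

/-- Strings of `t * n` bits are `t`-tuples of strings of `n` bits, and under this identification the
squared norm factors. -/
theorem sum_norm_copies (t : ℕ) {ψ : Bits n → ℂ} (hψ : ∑ x, ‖ψ x‖ ^ 2 = 1) :
    ∑ x : Bits (t * n), ‖∏ i : Fin t, ψ fun j => x (finProdFinEquiv (i, j))‖ ^ 2 = 1 := by
  rw [← ((Equiv.curry (Fin t) (Fin n) Bool).symm.trans
    (finProdFinEquiv.arrowCongr (Equiv.refl Bool))).sum_comp]
  have : ∀ p : Fin t → Bits n, ∀ i : Fin t, (fun j => ((Equiv.curry (Fin t) (Fin n) Bool).symm.trans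
      (finProdFinEquiv.arrowCongr (Equiv.refl Bool))) p (finProdFinEquiv (i, j))) = p i := by
    intro p i
    funext j
    simp [Function.uncurry]
  simp only [this, norm_prod, ← Finset.prod_pow]
  rw [← Fintype.prod_sum (fun (_ : Fin t) x => ‖ψ x‖ ^ 2)]
  simp [hψ]

/-- If a measurement almost certainly accepts the state `ψ`, then the probability that it accepts
another state bounds the overlap of that state with `ψ`. -/
theorem norm_braket_sq_le {m : Type*} [Fintype m] {T : Matrix m (Bits n) ℂ} (hT : Tᴴ * T = 1)
    (p : m → Prop) [DecidablePred p] {χ ψ : Bits n → ℂ} (hχ : ∑ x, ‖χ x‖ ^ 2 = 1)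
    (hψ : ∑ x, ‖ψ x‖ ^ 2 = 1) {ν : ℝ} (h : 1 - ν ≤ ∑ x, if p x then ‖(T *ᵥ ψ) x‖ ^ 2 else 0) :
    ‖braket χ ψ‖ ^ 2 ≤ 2 * (∑ x, if p x then ‖(T *ᵥ χ) x‖ ^ 2 else 0) + 2 * ν := by
  rw [← sum_norm_mulVec hT] at hχ hψ
  rw [← star_mulVec_dotProduct hT]
  simp only [← Finset.sum_filter] at h ⊢
  rw [← Finset.sum_filter_add_sum_filter_not _ p] at hχ hψ
  -- The overlap is split into the accepting and the rejecting outcomes, and Cauchy–Schwarz is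
  -- applied to each part.
  have h₀ : ‖star (T *ᵥ χ) ⬝ᵥ T *ᵥ ψ‖ ≤ ∑ x with p x, ‖(T *ᵥ χ) x‖ * ‖(T *ᵥ ψ) x‖ +
      ∑ x with ¬p x, ‖(T *ᵥ χ) x‖ * ‖(T *ᵥ ψ) x‖ := by
    rw [Finset.sum_filter_add_sum_filter_not]
    refine (norm_sum_le _ _).trans (le_of_eq ?_)
    refine Finset.sum_congr rfl fun x _ => ?_
    rw [norm_mul, Pi.star_apply, norm_star]
  have h₁ := Finset.sum_mul_sq_le_sq_mul_sq (Finset.univ.filter p) (fun x => ‖(T *ᵥ χ) x‖)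
    fun x => ‖(T *ᵥ ψ) x‖
  have h₂ := Finset.sum_mul_sq_le_sq_mul_sq (Finset.univ.filter fun x => ¬p x)
    (fun x => ‖(T *ᵥ χ) x‖) fun x => ‖(T *ᵥ ψ) x‖
  have p₁ : ∀ (v : m → ℂ) (s : Finset m), 0 ≤ ∑ x ∈ s, ‖v x‖ ^ 2 :=
    fun v s => Finset.sum_nonneg fun _ _ => by positivity
  have q₁ := p₁ (T *ᵥ χ) (Finset.univ.filter p)
  have q₂ := p₁ (T *ᵥ ψ) (Finset.univ.filter p)
  have q₃ := p₁ (T *ᵥ χ) (Finset.univ.filter fun x => ¬p x)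
  have q₄ := p₁ (T *ᵥ ψ) (Finset.univ.filter fun x => ¬p x)
  -- On accepting outcomes the weight of `ψ` is bounded by one; on rejecting outcomes, next, it is
  -- the weight of `χ`, and the weight of `ψ` that remains is at most `ν`.
  have r₁ := h₁.trans (mul_le_of_le_one_right q₁ (by linarith))
  have r₂ := h₂.trans (mul_le_of_le_one_left q₄ (by linarith))
  refine (pow_le_pow_left₀ (norm_nonneg _) h₀ 2).trans ?_
  -- The factors `2` come from `(x + y)² ≤ 2 (x² + y²)`.
  refine (add_sq_le).trans ?_
  linarith

end Pure

end QCrypto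

namespace QCrypto

open Matrix

/-! ### The action of classical gates -/

section Act

variable {w : ℕ} {ι : Type*}

/-- No control is a target and the targets are distinct, so the gates do not interact. -/
theorem gatesAct_map_cnot {c t : ι → Fin w} (h : ∀ i, c i ≠ t i) (ht : t.Injective)
    (hct : ∀ i j, c i ≠ t j) {l : List ι} (hl : l.Nodup) (y : Bits w) :
    (∀ i ∈ l, gatesAct (l.map fun i => .cnot (c i) (t i) (h i)) y (t i) =
      xor (y (t i)) (y (c i))) ∧
    ∀ j, (∀ i ∈ l, j ≠ t i) → gatesAct (l.map fun i => .cnot (c i) (t i) (h i)) y j = y j := by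
  induction l generalizing y with
  | nil => exact ⟨by simp, fun _ _ => rfl⟩
  | cons i l ih =>
    rw [List.nodup_cons] at hl
    obtain ⟨h₁, h₂⟩ := ih hl.2 ((Gate.cnot (c i) (t i) (h i)).act y)
    rw [List.map_cons]
    simp only [gatesAct_cons]
    constructor
    · intro i' hm
      rcases List.mem_cons.1 hm with rfl | hi'
      · rw [h₂ _ fun j hj => ht.ne (by rintro rfl; exact hl.1 hj)]
        simp [Gate.act]
      · rw [h₁ i' hi']
        have : i' ≠ i := by rintro rfl; exact hl.1 hi'
        simp [Gate.act, ht.eq_iff, this, hct]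
    · intro j hj
      rw [h₂ j fun i' hi' => hj i' (by simp [hi'])]
      simp [Gate.act, hj i (by simp)]

theorem gatesAct_map_x {t : ι → Fin w} (ht : t.Injective) {l : List ι} (hl : l.Nodup)
    (y : Bits w) :
    (∀ i ∈ l, gatesAct (l.map fun i => .x (t i)) y (t i) = !y (t i)) ∧
    ∀ j, (∀ i ∈ l, j ≠ t i) → gatesAct (l.map fun i => .x (t i)) y j = y j := by
  induction l generalizing y with
  | nil => exact ⟨by simp, fun _ _ => rfl⟩
  | cons i l ih =>
    rw [List.nodup_cons] at hl
    obtain ⟨h₁, h₂⟩ := ih hl.2 ((Gate.x (t i)).act y)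
    rw [List.map_cons]
    simp only [gatesAct_cons]
    constructor
    · intro i' hm
      rcases List.mem_cons.1 hm with rfl | hi'
      · rw [h₂ _ fun j hj => ht.ne (by rintro rfl; exact hl.1 hj)]
        simp [Gate.act]
      · rw [h₁ i' hi']
        have : i' ≠ i := by rintro rfl; exact hl.1 hi'
        simp [Gate.act, ht.eq_iff, this]
    · intro j hj
      rw [h₂ j fun i' hi' => hj i' (by simp [hi'])]
      simp [Gate.act, hj i (by simp)]

theorem gatesAct_swap {s t : Fin w} (h : s ≠ t) (y : Bits w) :
    gatesAct [.cnot s t h, .cnot t s h.symm, .cnot s t h] y = y ∘ Equiv.swap s t := by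
  funext j
  simp only [gatesAct, List.foldl_cons, List.foldl_nil, Gate.act, Function.comp_apply,
    Equiv.swap_apply_def, Function.update_apply, h, h.symm, if_false, if_true]
  by_cases hs : j = s
  · subst hs
    simp only [if_true, h, if_false]
    cases y j <;> cases y t <;> rfl
  · by_cases ht : j = t
    · subst ht
      simp only [h.symm, if_true, if_false]
      cases y j <;> cases y s <;> rfl
    · simp [hs, ht]

theorem gatesAct_flatMap_swap {s t : ι → Fin w} (h : ∀ i, s i ≠ t i) (hs : s.Injective)
    (ht : t.Injective) (hst : ∀ i j, s i ≠ t j) {l : List ι} (hl : l.Nodup) (y : Bits w) :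
    (∀ i ∈ l, gatesAct (l.flatMap fun i =>
      [.cnot (s i) (t i) (h i), .cnot (t i) (s i) (h i).symm, .cnot (s i) (t i) (h i)]) y (s i) =
        y (t i)) ∧
    (∀ i ∈ l, gatesAct (l.flatMap fun i =>
      [.cnot (s i) (t i) (h i), .cnot (t i) (s i) (h i).symm, .cnot (s i) (t i) (h i)]) y (t i) =
        y (s i)) ∧
    ∀ j, (∀ i ∈ l, j ≠ s i ∧ j ≠ t i) → gatesAct (l.flatMap fun i =>
      [.cnot (s i) (t i) (h i), .cnot (t i) (s i) (h i).symm, .cnot (s i) (t i) (h i)]) y j =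
        y j := by
  induction l generalizing y with
  | nil => exact ⟨by simp, by simp, fun _ _ => rfl⟩
  | cons i l ih =>
    rw [List.nodup_cons] at hl
    obtain ⟨h₁, h₂, h₃⟩ := ih hl.2 (y ∘ Equiv.swap (s i) (t i))
    rw [List.flatMap_cons]
    simp only [gatesAct_append, gatesAct_swap]
    have hne : ∀ i' ∈ l, i' ≠ i := by rintro i' hi' rfl; exact hl.1 hi'
    refine ⟨?_, ?_, ?_⟩
    · intro i' hm
      rcases List.mem_cons.1 hm with rfl | hi'
      · rw [h₃ _ fun j hj => ⟨hs.ne (hne j hj).symm, hst _ _⟩]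
        simp
      · rw [h₁ i' hi', Function.comp_apply,
          Equiv.swap_apply_of_ne_of_ne (hst _ _).symm (ht.ne (hne i' hi'))]
    · intro i' hm
      rcases List.mem_cons.1 hm with rfl | hi'
      · rw [h₃ _ fun j hj => ⟨(hst _ _).symm, ht.ne (hne j hj).symm⟩]
        simp
      · rw [h₂ i' hi', Function.comp_apply,
          Equiv.swap_apply_of_ne_of_ne (hs.ne (hne i' hi')) (hst _ _)]
    · intro j hj
      rw [h₃ j fun i' hi' => hj i' (by simp [hi']), Function.comp_apply,
        Equiv.swap_apply_of_ne_of_ne (hj i (by simp)).1 (hj i (by simp)).2]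

end Act

namespace QCircuit

variable {a b : ℕ} (C : QCircuit a b)

/-! ### The wires of the verification by projection -/

/-- The unused wire. -/
def idleWire : Fin C.projWidth := ⟨a + b + C.width, by unfold projWidth; omega⟩

theorem wire_cases (j : Fin C.projWidth) :
    (∃ i, j = C.keyWire i) ∨ (∃ i, j = C.stateWire i) ∨ (∃ i, j = C.blockWire i) ∨
      j = C.idleWire ∨ ∃ i, j = C.flagWire i := by
  have hj := j.isLt
  unfold projWidth at hj
  by_cases h₁ : j.val < a
  · exact Or.inl ⟨⟨j, h₁⟩, rfl⟩
  by_cases h₂ : j.val < a + b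
  · exact Or.inr (Or.inl ⟨⟨j - a, by omega⟩, Fin.ext (by simp; omega)⟩)
  by_cases h₃ : j.val < a + b + C.width
  · exact Or.inr (Or.inr (Or.inl ⟨⟨j - (a + b), by omega⟩, Fin.ext (by simp; omega)⟩))
  by_cases h₄ : j.val = a + b + C.width
  · exact Or.inr (Or.inr (Or.inr (Or.inl (Fin.ext h₄))))
  · exact Or.inr (Or.inr (Or.inr (Or.inr
      ⟨⟨j - (a + b + C.width + 1), by omega⟩, Fin.ext (by simp; omega)⟩)))

theorem keyWire_ne_blockWire (i : Fin a) (j : Fin C.width) : C.keyWire i ≠ C.blockWire j :=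
  Fin.ne_of_val_ne (by simp; omega)

theorem stateWire_ne_blockWire (i : Fin b) (j : Fin C.width) : C.stateWire i ≠ C.blockWire j :=
  Fin.ne_of_val_ne (by simp; omega)

theorem keyWire_ne_stateWire (i : Fin a) (j : Fin b) : C.keyWire i ≠ C.stateWire j :=
  Fin.ne_of_val_ne (by simp; omega)

theorem idleWire_ne_blockWire (j : Fin C.width) : C.idleWire ≠ C.blockWire j :=
  Fin.ne_of_val_ne (by simp [idleWire]; omega)

theorem idleWire_ne_stateWire (j : Fin b) : C.idleWire ≠ C.stateWire j :=
  Fin.ne_of_val_ne (by simp [idleWire]; omega)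

theorem flagWire_ne_blockWire (i : Fin (C.width + 1)) (j : Fin C.width) :
    C.flagWire i ≠ C.blockWire j :=
  Fin.ne_of_val_ne (by simp; omega)

theorem flagWire_ne_stateWire (i : Fin (C.width + 1)) (j : Fin b) :
    C.flagWire i ≠ C.stateWire j :=
  Fin.ne_of_val_ne (by simp; omega)

theorem injective_stateWire : (C.stateWire).Injective := fun i j h => by
  simpa [Fin.ext_iff] using h

theorem injective_flagWire : (C.flagWire).Injective := fun i j h => by
  simpa [Fin.ext_iff] using h

theorem injective_castLE {n w : ℕ} (h : n ≤ w) : (Fin.castLE h).Injective := fun i j h => by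
  simpa [Fin.ext_iff] using h

theorem notMem_range_blockWire (j : Fin C.projWidth) : j ∉ Set.range C.blockWire ↔
    (∃ i, j = C.keyWire i) ∨ (∃ i, j = C.stateWire i) ∨ j = C.idleWire ∨
      ∃ i, j = C.flagWire i := by
  constructor
  · intro hj
    rcases C.wire_cases j with h | h | ⟨i, rfl⟩ | h | h
    · exact Or.inl h
    · exact Or.inr (Or.inl h)
    · exact (hj ⟨i, rfl⟩).elim
    · exact Or.inr (Or.inr (Or.inl h))
    · exact Or.inr (Or.inr (Or.inr h))
  · rintro (⟨i, rfl⟩ | ⟨i, rfl⟩ | rfl | ⟨i, rfl⟩) ⟨i', h⟩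
    · exact C.keyWire_ne_blockWire _ _ h.symm
    · exact C.stateWire_ne_blockWire _ _ h.symm
    · exact C.idleWire_ne_blockWire _ h.symm
    · exact C.flagWire_ne_blockWire _ _ h.symm

/-! ### The classical parts of the verification by projection -/

/-- The gates act by exclusive or, which is why they serve twice: on a zero block they copy the key,
and after the backward run they compare the block with it. -/
theorem gatesAct_copyGates_blockWire (y : Bits C.projWidth) (j : Fin C.width) :
    gatesAct C.copyGates y (C.blockWire j) =
      xor (y (C.blockWire j)) (padBits (y ∘ C.keyWire) j) := by
  obtain ⟨h₁, h₂⟩ := gatesAct_map_cnot (fun i => C.keyWire_ne_blockWire i (Fin.castLE C.nin_le i))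
    (C.blockWire.injective.comp (injective_castLE C.nin_le))
    (fun i _ => C.keyWire_ne_blockWire i _) (List.nodup_finRange a) y
  by_cases hj : j.val < a
  · have := h₁ ⟨j, hj⟩ (List.mem_finRange _)
    rw [padBits, dif_pos hj]
    exact this
  · rw [padBits, dif_neg hj, Bool.xor_false]
    refine h₂ _ fun i _ h => hj ?_
    rw [C.blockWire.injective h]
    exact i.isLt

theorem gatesAct_copyGates_of_notMem (y : Bits C.projWidth) {j : Fin C.projWidth}
    (hj : j ∉ Set.range C.blockWire) : gatesAct C.copyGates y j = y j :=
  (gatesAct_map_cnot (fun i => C.keyWire_ne_blockWire i (Fin.castLE C.nin_le i))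
    (C.blockWire.injective.comp (injective_castLE C.nin_le))
    (fun i _ => C.keyWire_ne_blockWire i _) (List.nodup_finRange a) y).2 j
    fun _ _ h => hj ⟨_, h.symm⟩

theorem gatesAct_notGates_blockWire (y : Bits C.projWidth) (j : Fin C.width) :
    gatesAct C.notGates y (C.blockWire j) = !y (C.blockWire j) :=
  (gatesAct_map_x C.blockWire.injective (List.nodup_finRange _) y).1 j (List.mem_finRange _)

theorem gatesAct_notGates_of_notMem (y : Bits C.projWidth) {j : Fin C.projWidth}
    (hj : j ∉ Set.range C.blockWire) : gatesAct C.notGates y j = y j :=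
  (gatesAct_map_x C.blockWire.injective (List.nodup_finRange _) y).2 j
    fun _ _ h => hj ⟨_, h.symm⟩

theorem gatesAct_swapGates (y : Bits C.projWidth) :
    (∀ i, gatesAct C.swapGates y (C.stateWire i) = y (C.blockWire (Fin.castLE C.nout_le i))) ∧
    (∀ i, gatesAct C.swapGates y (C.blockWire (Fin.castLE C.nout_le i)) = y (C.stateWire i)) ∧
    ∀ j, (∀ i, j ≠ C.stateWire i ∧ j ≠ C.blockWire (Fin.castLE C.nout_le i)) →
      gatesAct C.swapGates y j = y j := by
  obtain ⟨h₁, h₂, h₃⟩ := gatesAct_flatMap_swap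
    (fun i => C.stateWire_ne_blockWire i (Fin.castLE C.nout_le i)) C.injective_stateWire
    (C.blockWire.injective.comp (injective_castLE C.nout_le))
    (fun i _ => C.stateWire_ne_blockWire i _) (List.nodup_finRange b) y
  exact ⟨fun i => h₁ i (List.mem_finRange _), fun i => h₂ i (List.mem_finRange _),
    fun j hj => h₃ j fun i _ => hj i⟩

theorem involutive_gatesAct_swapGates : (gatesAct C.swapGates).Involutive := by
  intro y
  obtain ⟨h₁, h₂, h₃⟩ := C.gatesAct_swapGates (gatesAct C.swapGates y)
  obtain ⟨h₁', h₂', h₃'⟩ := C.gatesAct_swapGates y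
  funext j
  by_cases hs : ∃ i, j = C.stateWire i
  · obtain ⟨i, rfl⟩ := hs
    rw [h₁, h₂']
  · by_cases hb : ∃ i, j = C.blockWire (Fin.castLE C.nout_le i)
    · obtain ⟨i, rfl⟩ := hb
      rw [h₂, h₁']
    · push Not at hs hb
      rw [h₃ j fun i => ⟨hs i, hb i⟩, h₃' j fun i => ⟨hs i, hb i⟩]

/-- A chain of conjunctions: each Toffoli gate sets the next flag to the previous flag and one more
wire of the block. -/
theorem gatesAct_flagGates_last {y : Bits C.projWidth} (h₀ : y (C.flagWire 0) = true)
    (h : ∀ i : Fin C.width, y (C.flagWire i.succ) = false) :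
    gatesAct C.flagGates y (C.flagWire (Fin.last _)) = true ↔ ∀ i, y (C.blockWire i) = true := by
  -- Invariant after `n` gates: flag `n` is the conjunction of the first `n` wires, the later flags
  -- are still clear, and the block is untouched.
  have key : ∀ n (hn : n ≤ C.width), ∃ z, gatesAct (C.flagGates.take n) y = z ∧
      (z (C.flagWire ⟨n, by omega⟩) = true ↔ ∀ i : Fin C.width, i.val < n → y (C.blockWire i) = true) ∧
      (∀ i : Fin (C.width + 1), n < i.val → z (C.flagWire i) = false) ∧
      ∀ i, z (C.blockWire i) = y (C.blockWire i) := by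
    intro n
    induction n with
    | zero =>
      refine fun hn => ⟨y, by simp [gatesAct], ?_, ?_, fun _ => rfl⟩
      · simpa using h₀
      · intro i hi
        have := h (i.pred (by rintro rfl; simp at hi))
        simpa using this
    | succ n ih =>
      intro hn
      obtain ⟨z, hz, h₁, h₂, h₃⟩ := ih (by omega)
      have hlen : n < C.flagGates.length := by simp [flagGates]; omega
      obtain ⟨e₁, e₂, e₃, hg⟩ : ∃ e₁ e₂ e₃, C.flagGates[n] = .tof (C.blockWire ⟨n, hn⟩)
          (C.flagWire (Fin.castSucc ⟨n, hn⟩)) (C.flagWire (Fin.succ ⟨n, hn⟩)) e₁ e₂ e₃ :=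
        ⟨(C.flagWire_ne_blockWire _ _).symm, (C.flagWire_ne_blockWire _ _).symm,
          C.injective_flagWire.ne (by simp [Fin.ext_iff]), by simp [flagGates]⟩
      refine ⟨_, rfl, ?_⟩
      rw [List.take_succ_eq_append_getElem hlen, gatesAct_append, hz, hg]
      simp only [gatesAct, List.foldl_cons, List.foldl_nil, Gate.act]
      refine ⟨?_, ?_, ?_⟩
      · rw [show (⟨n + 1, by omega⟩ : Fin (C.width + 1)) = Fin.succ ⟨n, hn⟩ from rfl,
          Function.update_self, h₂ (Fin.succ ⟨n, hn⟩) (by simp), Bool.false_xor, Bool.and_eq_true,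
          h₃, show Fin.castSucc ⟨n, hn⟩ = (⟨n, by omega⟩ : Fin (C.width + 1)) from rfl, h₁]
        constructor
        · rintro ⟨h, h'⟩ i hi
          by_cases hin : i.val = n
          · rw [← h]; congr 2; exact Fin.ext hin
          · exact h' i (by omega)
        · intro h
          exact ⟨h _ (by simp), fun i hi => h i (by omega)⟩
      · intro i hi
        rw [Function.update_of_ne, h₂ i (by omega)]
        exact C.injective_flagWire.ne (by rintro rfl; simp at hi)
      · intro i
        rw [Function.update_of_ne (C.flagWire_ne_blockWire _ _).symm, h₃]
  obtain ⟨z, hz, h₁, -⟩ := key C.width le_rfl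
  have : C.flagGates.take C.width = C.flagGates :=
    List.take_of_length_le (by simp [flagGates])
  rw [this] at hz
  rw [hz, show Fin.last C.width = ⟨C.width, by omega⟩ from rfl, h₁]
  exact ⟨fun h i => h i i.isLt, fun h i _ => h i⟩

/-- The gates that test whether the block equals the input of `C`. -/
def testGates : List (Gate C.projWidth) :=
  C.copyGates ++ C.notGates ++ [.x (C.flagWire 0)] ++ C.flagGates ++ C.outGates

/-- Adding the padded key clears the block exactly if the two were equal; after negation this says
that all wires of the block are one, which the flags detect. -/
theorem gatesAct_testGates {y : Bits C.projWidth} (hy : ∀ i, y (C.flagWire i) = false) :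
    gatesAct C.testGates y C.outWire = true ↔ y ∘ C.blockWire = padBits (y ∘ C.keyWire) := by
  have hout : ∀ z, gatesAct C.outGates z C.outWire = z (C.flagWire (Fin.last _)) := by
    intro z
    have h : C.outWire ≠ C.flagWire (Fin.last _) := by
      simp only [ne_eq, Fin.ext_iff]; simp; omega
    simp only [outGates, gatesAct, List.foldl_cons, List.foldl_nil, Gate.act, Function.update_self,
      Function.update_of_ne h]
    cases z C.outWire <;> simp
  have hx : ∀ (z : Bits C.projWidth) j, j ≠ C.flagWire 0 →
      gatesAct [.x (C.flagWire 0)] z j = z j := by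
    intro z j hj
    simp [gatesAct, Gate.act, hj]
  have hfb : ∀ i, C.flagWire i ∉ Set.range C.blockWire := fun i =>
    (C.notMem_range_blockWire _).2 (Or.inr (Or.inr (Or.inr ⟨i, rfl⟩)))
  have hflag : ∀ i, gatesAct C.notGates (gatesAct C.copyGates y) (C.flagWire i) = false := by
    intro i
    rw [C.gatesAct_notGates_of_notMem _ (hfb i), C.gatesAct_copyGates_of_notMem _ (hfb i), hy]
  simp only [testGates, gatesAct_append]
  rw [hout, C.gatesAct_flagGates_last]
  · rw [funext_iff]
    refine forall_congr' fun i => ?_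
    rw [hx _ _ (C.flagWire_ne_blockWire _ _).symm, gatesAct_notGates_blockWire,
      gatesAct_copyGates_blockWire, Function.comp_apply]
    cases y (C.blockWire i) <;> cases (padBits (y ∘ C.keyWire) : Bits C.width) i <;> simp
  · have := hflag 0
    simpa [gatesAct, Gate.act] using this
  · intro i
    rw [hx _ _ (C.injective_flagWire.ne (Fin.succ_ne_zero i)), hflag]

theorem isClassical_copyGates : ∀ g ∈ C.copyGates, g.IsClassical := by
  simp [copyGates, Gate.IsClassical]

theorem isClassical_swapGates : ∀ g ∈ C.swapGates, g.IsClassical := by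
  intro g hg
  simp only [swapGates, List.mem_flatMap, List.mem_cons, List.not_mem_nil, or_false] at hg
  obtain ⟨i, -, rfl | rfl | rfl⟩ := hg <;> trivial

theorem isClassical_testGates : ∀ g ∈ C.testGates, g.IsClassical := by
  intro g hg
  simp only [testGates, List.mem_append, copyGates, notGates, flagGates, outGates, List.mem_map,
    List.mem_cons, List.not_mem_nil, or_false] at hg
  obtain (((⟨i, -, rfl⟩ | ⟨i, -, rfl⟩) | rfl) | ⟨i, -, rfl⟩) | rfl | rfl := hg <;> trivial

end QCircuit

end QCrypto

namespace QCrypto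

open Matrix

namespace QCircuit

variable {a b : ℕ} (C : QCircuit a b)

/-! ### The acceptance probability of the verification by projection -/

/-- The output wires of a circuit. -/
def outEmb : Fin b ↪ Fin C.width := ⟨Fin.castLE C.nout_le, injective_castLE C.nout_le⟩

/-- The partial trace determines the first index from the second by replacing the output bits with
`s`. The single sum left over is the form in which the amplitude of `preTest` appears. -/
theorem run_classical_apply (k : Bits a) (s u : Bits b) :
    C.run (classical k) s u = ∑ x : Bits C.width, if x ∘ C.outEmb = u then
      C.unitary (replaceBits C.outEmb s x) (padBits k) * star (C.unitary x (padBits k)) else 0 := by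
  have hM : ∀ x y, (C.unitary * padZero C.nin_le (classical k) * C.unitaryᴴ) x y =
      C.unitary x (padBits k) * star (C.unitary y (padBits k)) := by
    intro x y
    rw [padZero_eq, mul_embed_mul]
    simp only [mul_apply, classical, single_apply, conjTranspose_apply, submatrix_apply, id]
    rw [Finset.sum_eq_single k]
    · rw [Finset.sum_eq_single k]
      · simp
      · intro j _ hj
        simp [hj.symm]
      · simp
    · intro j _ hj
      rw [Finset.sum_eq_zero, zero_mul]
      intro i _
      simp [hj.symm]
    · simp
  rw [QCircuit.run, traceRest, Finset.sum_comm]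
  refine Finset.sum_congr rfl fun y _ => ?_
  simp only [hM]
  have hout : ∀ j : Fin C.width, j ∈ Set.range C.outEmb ↔ j.val < b := by
    intro j
    constructor
    · rintro ⟨i, rfl⟩; exact i.isLt
    · intro h; exact ⟨⟨j, h⟩, rfl⟩
  rw [Finset.sum_eq_single (replaceBits C.outEmb s y)]
  · refine if_congr ?_ rfl rfl
    constructor
    · rintro ⟨-, h, -⟩
      exact funext h
    · intro h
      refine ⟨fun i => replaceBits_apply C.outEmb s y i, congrFun h, fun j hj => ?_⟩
      exact replaceBits_of_notMem _ _ _ (by rw [hout]; omega)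
  · intro x _ hx
    rw [if_neg]
    rintro ⟨h₁, -, h₃⟩
    refine hx ?_
    have := replaceBits_self C.outEmb (x := y) (y := x) fun j hj =>
      (h₃ j (by rw [hout] at hj; omega)).symm
    rw [← this]
    congr 1
    exact funext h₁
  · simp

/-- The basis state in which the input of `C`, the state to be measured and the block hold the
strings `k`, `u` and `k`. -/
def initBits (k : Bits a) (u : Bits b) : Bits C.projWidth :=
  gatesAct C.copyGates (padBits (Fin.append k u))

section InitBits

variable (k : Bits a) (u : Bits b)

theorem padBits_append_keyWire (i : Fin a) :
    (padBits (Fin.append k u) : Bits C.projWidth) (C.keyWire i) = k i :=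
  (padBits_castLE C.projVer.nin_le _ (Fin.castAdd b i)).trans (Fin.append_left k u i)

theorem padBits_append_stateWire (i : Fin b) :
    (padBits (Fin.append k u) : Bits C.projWidth) (C.stateWire i) = u i :=
  (padBits_castLE C.projVer.nin_le _ (Fin.natAdd a i)).trans (Fin.append_right k u i)

theorem initBits_keyWire (i : Fin a) : C.initBits k u (C.keyWire i) = k i := by
  rw [initBits, gatesAct_copyGates_of_notMem, padBits_append_keyWire]
  exact (C.notMem_range_blockWire _).2 (Or.inl ⟨i, rfl⟩)

theorem initBits_stateWire (i : Fin b) : C.initBits k u (C.stateWire i) = u i := by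
  rw [initBits, gatesAct_copyGates_of_notMem, padBits_append_stateWire]
  exact (C.notMem_range_blockWire _).2 (Or.inr (Or.inl ⟨i, rfl⟩))

theorem initBits_idleWire : C.initBits k u C.idleWire = false := by
  rw [initBits, gatesAct_copyGates_of_notMem]
  · simp [padBits, idleWire]
  · exact (C.notMem_range_blockWire _).2 (Or.inr (Or.inr (Or.inl rfl)))

theorem initBits_flagWire (i : Fin (C.width + 1)) : C.initBits k u (C.flagWire i) = false := by
  rw [initBits, gatesAct_copyGates_of_notMem]
  · rw [padBits, dif_neg]
    simp
    omega
  · exact (C.notMem_range_blockWire _).2 (Or.inr (Or.inr (Or.inr ⟨i, rfl⟩)))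

theorem initBits_comp_blockWire : C.initBits k u ∘ C.blockWire = padBits k := by
  funext j
  rw [Function.comp_apply, initBits, gatesAct_copyGates_blockWire]
  have h₁ : (padBits (Fin.append k u) : Bits C.projWidth) (C.blockWire j) = false := by
    rw [padBits, dif_neg]
    simp
  have h₂ : (padBits (Fin.append k u) : Bits C.projWidth) ∘ C.keyWire = k :=
    funext fun i => C.padBits_append_keyWire k u i
  rw [h₁, h₂, Bool.false_xor]

theorem initBits_comp_keyWire : C.initBits k u ∘ C.keyWire = k :=
  funext fun i => C.initBits_keyWire k u i

theorem initBits_comp_stateWire : C.initBits k u ∘ C.stateWire = u :=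
  funext fun i => C.initBits_stateWire k u i

theorem injective_initBits : (C.initBits k).Injective := by
  intro u v h
  rw [← C.initBits_comp_stateWire k u, h, initBits_comp_stateWire]

end InitBits

/-- A basis state of the form `C.initBits k s`, up to the contents of the block. -/
def IsReset (k : Bits a) (z : Bits C.projWidth) : Prop :=
  (∀ i, z (C.keyWire i) = k i) ∧ z C.idleWire = false ∧ ∀ i, z (C.flagWire i) = false

instance (k : Bits a) (z : Bits C.projWidth) : Decidable (C.IsReset k z) :=
  inferInstanceAs (Decidable (_ ∧ _ ∧ _))

theorem eq_initBits_of_isReset {k : Bits a} {z : Bits C.projWidth} (hz : C.IsReset k z)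
    (h : z ∘ C.blockWire = padBits k) : z = C.initBits k (z ∘ C.stateWire) := by
  funext j
  rcases C.wire_cases j with ⟨i, rfl⟩ | ⟨i, rfl⟩ | ⟨i, rfl⟩ | rfl | ⟨i, rfl⟩
  · rw [initBits_keyWire, hz.1]
  · rw [initBits_stateWire]; rfl
  · exact (congrFun h i).trans (congrFun (C.initBits_comp_blockWire k _) i).symm
  · rw [initBits_idleWire, hz.2.1]
  · rw [initBits_flagWire, hz.2.2]

theorem isReset_initBits (k : Bits a) (u : Bits b) : C.IsReset k (C.initBits k u) :=
  ⟨C.initBits_keyWire k u, C.initBits_idleWire k u, C.initBits_flagWire k u⟩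

/-- The state of the circuit before the test, as a matrix in terms of the state to be measured. -/
noncomputable def preTest (k : Bits a) : Matrix (Bits C.projWidth) (Bits b) ℂ :=
  (lift C.blockWire C.unitaryᴴ * (basisMap (gatesAct C.swapGates) *
    (lift C.blockWire C.unitary * basisMap (gatesAct C.copyGates)))).submatrix id
      fun u => padBits (Fin.append k u)

theorem unitary_projVer : C.projVer.unitary = basisMap (gatesAct C.testGates) *
    (lift C.blockWire C.unitaryᴴ * (basisMap (gatesAct C.swapGates) *
      (lift C.blockWire C.unitary * basisMap (gatesAct C.copyGates)))) := by
  have hd : (C.gates.reverse.map fun g => g.inv.map C.blockWire) =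
      (C.gates.reverse.map Gate.inv).map (Gate.map C.blockWire) := by
    rw [List.map_map]; rfl
  have hg : C.projVer.gates = C.copyGates ++ (C.gates.map (Gate.map C.blockWire) ++
      (C.swapGates ++ ((C.gates.reverse.map Gate.inv).map (Gate.map C.blockWire) ++
        C.testGates))) := by
    simp only [projVer, testGates, List.append_assoc, hd]
  refine (congrArg (gatesMat (w := C.projWidth)) hg).trans ?_
  simp only [gatesMat_append, gatesMat_map, gatesMat_reverse_map_inv,
    gatesMat_of_isClassical C.isClassical_copyGates,
    gatesMat_of_isClassical C.isClassical_swapGates,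
    gatesMat_of_isClassical C.isClassical_testGates, ← Matrix.mul_assoc]
  rfl

theorem isomAt_projVer (k : Bits a) :
    C.projVer.isomAt k = basisMap (gatesAct C.testGates) * C.preTest k := by
  ext x u
  exact congrFun (congrFun C.unitary_projVer x) _

theorem gatesAct_swapGates_comp_blockWire (x : Bits C.projWidth) :
    gatesAct C.swapGates x ∘ C.blockWire =
      replaceBits C.outEmb (x ∘ C.stateWire) (x ∘ C.blockWire) := by
  obtain ⟨-, h₂, h₃⟩ := C.gatesAct_swapGates x
  funext j
  by_cases hj : j ∈ Set.range C.outEmb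
  · obtain ⟨i, rfl⟩ := hj
    rw [replaceBits_apply]
    exact h₂ i
  · rw [replaceBits_of_notMem _ _ _ hj, Function.comp_apply, h₃]
    · rfl
    · exact fun i => ⟨(C.stateWire_ne_blockWire _ _).symm,
        fun h => hj ⟨i, (C.blockWire.injective h).symm⟩⟩

/-- Identifies the surviving terms of the amplitude. Before the swap, everything outside the block
must be as at the start; in particular the state wires hold `u`, which are the output bits of `c`
after the swap. -/
theorem gatesAct_swapGates_agree_iff (k : Bits a) (u : Bits b) (c : Bits C.width)
    (z : Bits C.projWidth) :
    (∀ j, j ∉ Set.range C.blockWire →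
      gatesAct C.swapGates (replaceBits C.blockWire c z) j = C.initBits k u j) ↔
      C.IsReset k z ∧ c ∘ C.outEmb = u := by
  obtain ⟨h₁, h₂, h₃⟩ := C.gatesAct_swapGates (replaceBits C.blockWire c z)
  have hk : ∀ i, gatesAct C.swapGates (replaceBits C.blockWire c z) (C.keyWire i) =
      z (C.keyWire i) := by
    intro i
    rw [h₃ _ fun j => ⟨C.keyWire_ne_stateWire _ _, C.keyWire_ne_blockWire _ _⟩,
      replaceBits_of_notMem]
    exact (C.notMem_range_blockWire _).2 (Or.inl ⟨i, rfl⟩)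
  have hs : ∀ i, gatesAct C.swapGates (replaceBits C.blockWire c z) (C.stateWire i) =
      c (C.outEmb i) := by
    intro i
    rw [h₁, replaceBits_apply]
    rfl
  have hi : gatesAct C.swapGates (replaceBits C.blockWire c z) C.idleWire = z C.idleWire := by
    rw [h₃ _ fun j => ⟨C.idleWire_ne_stateWire _, C.idleWire_ne_blockWire _⟩,
      replaceBits_of_notMem]
    exact (C.notMem_range_blockWire _).2 (Or.inr (Or.inr (Or.inl rfl)))
  have hf : ∀ i, gatesAct C.swapGates (replaceBits C.blockWire c z) (C.flagWire i) =
      z (C.flagWire i) := by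
    intro i
    rw [h₃ _ fun j => ⟨C.flagWire_ne_stateWire _ _, C.flagWire_ne_blockWire _ _⟩,
      replaceBits_of_notMem]
    exact (C.notMem_range_blockWire _).2 (Or.inr (Or.inr (Or.inr ⟨i, rfl⟩)))
  simp only [notMem_range_blockWire]
  constructor
  · intro h
    refine ⟨⟨fun i => ?_, ?_, fun i => ?_⟩, funext fun i => ?_⟩
    · rw [← hk, h _ (Or.inl ⟨i, rfl⟩), initBits_keyWire]
    · rw [← hi, h _ (Or.inr (Or.inr (Or.inl rfl))), initBits_idleWire]
    · rw [← hf, h _ (Or.inr (Or.inr (Or.inr ⟨i, rfl⟩))), initBits_flagWire]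
    · rw [Function.comp_apply, ← hs, h _ (Or.inr (Or.inl ⟨i, rfl⟩)), initBits_stateWire]
  · rintro ⟨h, h'⟩ j (⟨i, rfl⟩ | ⟨i, rfl⟩ | rfl | ⟨i, rfl⟩)
    · rw [hk, h.1, initBits_keyWire]
    · rw [hs, initBits_stateWire, ← h']; rfl
    · rw [hi, h.2.1, initBits_idleWire]
    · rw [hf, h.2.2, initBits_flagWire]

/-- Expanded from the left: the backward run gives the sum over `c`, the swap only permutes the
index, and the forward run contributes one entry of the unitary if the wires outside the block
agree. -/
theorem preTest_apply (k : Bits a) (z : Bits C.projWidth) (u : Bits b) :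
    C.preTest k z u = ∑ c, star (C.unitary c (z ∘ C.blockWire)) *
      if C.IsReset k z ∧ c ∘ C.outEmb = u then
        C.unitary (replaceBits C.outEmb (z ∘ C.stateWire) c) (padBits k) else 0 := by
  rw [preTest, submatrix_apply, id, lift_mul_apply]
  refine Finset.sum_congr rfl fun c _ => ?_
  rw [conjTranspose_apply]
  congr 1
  -- Writing the row index as a double swap lets the permutation matrix act by moving to another
  -- row.
  have h := C.involutive_gatesAct_swapGates (replaceBits C.blockWire c z)
  conv_lhs => rw [← h]
  rw [basisMap_mul_apply C.involutive_gatesAct_swapGates.injective, mul_basisMap_apply, lift]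
  change (if ∀ j, j ∉ Set.range C.blockWire → gatesAct C.swapGates (replaceBits C.blockWire c z) j =
    C.initBits k u j then _ else _) = _
  rw [if_congr (C.gatesAct_swapGates_agree_iff k u c z) rfl rfl]
  congr 2
  · rw [gatesAct_swapGates_comp_blockWire, replaceBits_comp]
    congr 1
    funext i
    rw [Function.comp_apply, replaceBits_of_notMem]
    · rfl
    · exact (C.notMem_range_blockWire _).2 (Or.inr (Or.inl ⟨i, rfl⟩))
  · exact C.initBits_comp_blockWire k u

theorem preTest_of_not_isReset {k : Bits a} {z : Bits C.projWidth} (hz : ¬C.IsReset k z)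
    (u : Bits b) : C.preTest k z u = 0 := by
  simp [preTest_apply, hz]

/-- The heart of the construction: the amplitude for the block to return to `k` is the density
operator itself. The swap inserts `u` and `s` on the output wires, and the sum over the other wires
is the partial trace. Purity plays no role here. -/
theorem preTest_initBits (k : Bits a) (s u : Bits b) :
    C.preTest k (C.initBits k s) u = C.run (classical k) s u := by
  rw [preTest_apply, run_classical_apply]
  refine Finset.sum_congr rfl fun c _ => ?_
  rw [initBits_comp_blockWire, initBits_comp_stateWire]
  simp only [C.isReset_initBits k s, true_and]
  split_ifs
  · rw [mul_comm]
  · simp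

/-- The test permutes basis states, so it only decides which of them count. Those accepted with
possibly nonzero amplitude are the `C.initBits k s`, and summing over `s` gives the trace. -/
theorem outcomeProb_projVer (k : Bits a) (ρ : Op b) :
    outcomeProb (C.projVer.run (tensor (classical k) ρ)) (fun _ => true) =
      ((C.run (classical k) * ρ * (C.run (classical k))ᴴ).trace).re := by
  have hf : Function.Bijective (gatesAct C.testGates) :=
    Finite.injective_iff_bijective.1 (injective_gatesAct _)
  have hw : ∀ i, Fin.castLE C.projVer.nout_le i = C.outWire := by
    intro i
    ext
    simp
  have hrun : outcomeProb (C.projVer.run (tensor (classical k) ρ)) (fun _ => true) =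
      ∑ x : Bits C.projWidth, if x C.outWire = true then
        ((basisMap (gatesAct C.testGates) * C.preTest k * ρ *
          (basisMap (gatesAct C.testGates) * C.preTest k)ᴴ) x x).re else 0 := by
    rw [outcomeProb_run_tensor, isomAt_projVer]
    simp only [hw, forall_const]
    rfl
  rw [hrun]
  have hpre : ∀ z, ((basisMap (gatesAct C.testGates) * C.preTest k * ρ *
      (basisMap (gatesAct C.testGates) * C.preTest k)ᴴ) (gatesAct C.testGates z)
        (gatesAct C.testGates z)) = (C.preTest k * ρ * (C.preTest k)ᴴ) z z := by
    intro z
    rw [mul_apply, mul_apply (M := C.preTest k * ρ)]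
    refine Finset.sum_congr rfl fun v _ => ?_
    rw [conjTranspose_apply, basisMap_mul_apply hf.1, mul_apply (N := ρ), mul_apply (N := ρ)]
    simp only [basisMap_mul_apply hf.1]
    rfl
  rw [← (Equiv.ofBijective _ hf).sum_comp]
  change (∑ z : Bits C.projWidth, if gatesAct C.testGates z C.outWire = true then
    ((basisMap (gatesAct C.testGates) * C.preTest k * ρ *
      (basisMap (gatesAct C.testGates) * C.preTest k)ᴴ) (gatesAct C.testGates z)
        (gatesAct C.testGates z)).re else 0) = _
  simp only [hpre]
  rw [trace, Complex.re_sum]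
  -- Outside the image of `initBits` a term vanishes for one of two reasons: the key, idle or flag
  -- wires have the wrong content, so the amplitude is zero, or the test rejects.
  refine (Fintype.sum_of_injective _ (C.injective_initBits k) _ _ ?_ ?_).symm
  · intro z hz
    by_cases hr : C.IsReset k z
    · rw [if_neg]
      rw [C.gatesAct_testGates hr.2.2]
      intro h
      refine hz ⟨_, (C.eq_initBits_of_isReset hr ?_).symm⟩
      rw [h]
      congr 1
      exact funext hr.1
    · have : (C.preTest k * ρ * (C.preTest k)ᴴ) z z = 0 := by
        simp [mul_apply, C.preTest_of_not_isReset hr]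
      simp [this]
  · intro s
    rw [if_pos]
    · simp only [diag_apply, mul_apply, conjTranspose_apply, preTest_initBits]
    · rw [C.gatesAct_testGates (C.isReset_initBits k s).2.2, initBits_comp_blockWire,
        initBits_comp_keyWire]

end QCircuit

/-- The operator of a unit vector is a self-adjoint idempotent, so by cyclicity of the trace one of
the two factors disappears. -/
theorem trace_pureOp_mul_mul {n : ℕ} {ψ : Bits n → ℂ} (hψ : braket ψ ψ = 1) (ρ : Op n) :
    (pureOp ψ * ρ * (pureOp ψ)ᴴ).trace = braket ψ (ρ *ᵥ ψ) := by
  have h : (pureOp ψ)ᴴ = pureOp ψ := by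
    rw [pureOp, conjTranspose_vecMulVec, star_star]
  rw [h, trace_mul_comm, ← Matrix.mul_assoc, pureOp, vecMulVec_mul_vecMulVec,
    show star ψ ⬝ᵥ ψ = 1 from hψ, one_smul, vecMulVec_mul, trace_vecMulVec, braket,
    dotProduct_comm, dotProduct_mulVec]

theorem im_braket_mulVec {n : ℕ} {ρ : Op n} (hρ : ρ.IsHermitian) (ψ : Bits n → ℂ) :
    (braket ψ (ρ *ᵥ ψ)).im = 0 := by
  rw [← Complex.conj_eq_iff_im, braket, starRingEnd_apply, ← star_dotProduct, star_mulVec, hρ.eq,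
    ← dotProduct_mulVec]

end QCrypto

namespace QCrypto

open Matrix
open scoped ComplexOrder

/-! ### One-way state generators with pure outputs -/

theorem Negligible.zero : Negligible fun _ => 0 := Asymptotics.superpolynomialDecay_zero _ _

theorem Negligible.two_mul_add {ν μ : ℕ → ℝ} (hν : Negligible ν) (hμ : Negligible μ) :
    Negligible fun n => 2 * ν n + 2 * μ n := by
  have h := (hν.const_mul 2).add (hμ.const_mul 2)
  exact h

section Schemes

variable {κ m : ℕ → ℕ}

theorem keyProb_nonneg (KeyGen : ∀ n, QCircuit 0 (κ n)) (n : ℕ) (k : Bits (κ n)) :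
    0 ≤ keyProb KeyGen n k := by
  rw [keyProb, one_eq_pureOp]
  exact outcomeProb_run_pureOp_nonneg _ _ _

theorem sum_keyProb (KeyGen : ∀ n, QCircuit 0 (κ n)) (n : ℕ) : ∑ k, keyProb KeyGen n k = 1 := by
  simp only [keyProb, one_eq_pureOp]
  exact sum_outcomeProb_run_pureOp _ (by simp)

variable {StateGen : ∀ n, QCircuit (κ n) (m n)}

theorem guessProb_nonneg {n : ℕ} {k : Bits (κ n)} {ψ : Bits (m n) → ℂ}
    (hψ : IsPureStateOf (genState StateGen n k) ψ) (t : Polynomial ℕ)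
    (A : ∀ n, QCircuit (t.eval n * m n) (κ n)) (k' : Bits (κ n)) :
    0 ≤ guessProb StateGen t A n k k' := by
  rw [guessProb, hψ.2, copies_pureOp]
  exact outcomeProb_run_pureOp_nonneg _ _ _

theorem sum_guessProb {n : ℕ} {k : Bits (κ n)} {ψ : Bits (m n) → ℂ}
    (hψ : IsPureStateOf (genState StateGen n k) ψ) (t : Polynomial ℕ)
    (A : ∀ n, QCircuit (t.eval n * m n) (κ n)) :
    ∑ k', guessProb StateGen t A n k k' = 1 := by
  simp only [guessProb, hψ.2, copies_pureOp]
  exact sum_outcomeProb_run_pureOp _ (sum_norm_copies _ ((braket_self_eq_one_iff ψ).1 hψ.1))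

theorem verProb_pureOp (Ver : ∀ n, QCircuit (κ n + m n) 1) (n : ℕ) (k : Bits (κ n))
    (ψ : Bits (m n) → ℂ) :
    verProb Ver n k (pureOp ψ) = ∑ x : Bits (Ver n).width,
      if ∀ i, x (Fin.castLE (Ver n).nout_le i) = true then
        ‖((Ver n).isomAt k *ᵥ ψ) x‖ ^ 2 else 0 := by
  simp only [verProb, outcomeProb_run_tensor, mul_pureOp_mul]

/-- A verification that almost certainly accepts the right states accepts any other state with a
probability that bounds the overlap. -/
theorem norm_braket_sq_le_verProb (Ver : ∀ n, QCircuit (κ n + m n) 1) {n : ℕ} {k k' : Bits (κ n)}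
    {χ ψ : Bits (m n) → ℂ} (hχ : IsPureStateOf (genState StateGen n k) χ)
    (hψ : IsPureStateOf (genState StateGen n k') ψ) {ν : ℝ}
    (h : 1 - ν ≤ verProb Ver n k' (genState StateGen n k')) :
    ‖braket χ ψ‖ ^ 2 ≤ 2 * verProb Ver n k' (genState StateGen n k) + 2 * ν := by
  rw [hψ.2, verProb_pureOp] at h
  rw [hχ.2, verProb_pureOp]
  exact norm_braket_sq_le ((Ver n).conjTranspose_isomAt_mul_isomAt k') _
    ((braket_self_eq_one_iff χ).1 hχ.1) ((braket_self_eq_one_iff ψ).1 hψ.1) h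

theorem verProb_projVer {n : ℕ} {k : Bits (κ n)} {ψ : Bits (m n) → ℂ}
    (hψ : IsPureStateOf (genState StateGen n k) ψ) (ρ : Op (m n)) :
    verProb (fun n => (StateGen n).projVer) n k ρ = (braket ψ (ρ *ᵥ ψ)).re := by
  have h : (StateGen n).run (classical k) = pureOp ψ := hψ.2
  rw [verProb, QCircuit.outcomeProb_projVer, h, trace_pureOp_mul_mul hψ.1]

theorem isProjectionVer_projVer : IsProjectionVer StateGen fun n => (StateGen n).projVer := by
  intro n k ψ hψ ρ hρ
  rw [verProb_projVer hψ]
  apply Complex.ext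
  · simp
  · rw [Complex.ofReal_im, im_braket_mulVec hρ.1.isHermitian]

theorem verProb_projVer_genState {n : ℕ} {k k' : Bits (κ n)} {χ ψ : Bits (m n) → ℂ}
    (hχ : IsPureStateOf (genState StateGen n k) χ) (hψ : IsPureStateOf (genState StateGen n k') ψ) :
    verProb (fun n => (StateGen n).projVer) n k' (genState StateGen n k) = ‖braket χ ψ‖ ^ 2 := by
  rw [verProb_projVer hψ, hχ.2]
  have h : braket ψ (pureOp χ *ᵥ ψ) = star (braket χ ψ) * braket χ ψ := by
    simp only [braket, pureOp, vecMulVec_mulVec]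
    rw [dotProduct_smul, ← star_dotProduct]
    simp [mul_comm]
  rw [h, mul_comm, ← starRingEnd_apply, Complex.mul_conj, Complex.ofReal_re,
    Complex.normSq_eq_norm_sq]

/-- A one-way state generator whose outputs are pure and are almost certainly accepted remains one if
the verification is replaced by the verification by projection. -/
theorem IsOWSG.projVer {KeyGen : ∀ n, QCircuit 0 (κ n)} {Ver : ∀ n, QCircuit (κ n + m n) 1}
    (hOWSG : IsOWSG KeyGen StateGen Ver)
    (hpure : ∀ n k, ∃ ψ, IsPureStateOf (genState StateGen n k) ψ)
    (hver : ∃ ν, Negligible ν ∧ ∀ n k, 1 - ν n ≤ verProb Ver n k (genState StateGen n k)) :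
    IsOWSG KeyGen StateGen fun n => (StateGen n).projVer where
  keyGen_qpt := hOWSG.keyGen_qpt
  stateGen_qpt := hOWSG.stateGen_qpt
  ver_qpt := isQPT_projVer hOWSG.stateGen_qpt
  correct := by
    refine ⟨_, Negligible.zero, fun n => ?_⟩
    have : ∀ k, verProb (fun n => (StateGen n).projVer) n k (genState StateGen n k) = 1 := by
      intro k
      obtain ⟨ψ, hψ⟩ := hpure n k
      rw [verProb_projVer_genState hψ hψ, hψ.1]
      simp
    simp only [this, mul_one, sum_keyProb]
    simp
  secure := by
    intro t A hA
    obtain ⟨ν, hν, hver⟩ := hver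
    obtain ⟨μ, hμ, hsec⟩ := hOWSG.secure t A hA
    refine ⟨_, hμ.two_mul_add hν, fun n => ?_⟩
    choose φ hφ using hpure n
    calc ∑ k, ∑ k', keyProb KeyGen n k * guessProb StateGen t A n k k' *
          verProb (fun n => (StateGen n).projVer) n k' (genState StateGen n k)
        ≤ ∑ k, ∑ k', keyProb KeyGen n k * guessProb StateGen t A n k k' *
          (2 * verProb Ver n k' (genState StateGen n k) + 2 * ν n) := by
          refine Finset.sum_le_sum fun k _ => Finset.sum_le_sum fun k' _ => ?_
          rw [verProb_projVer_genState (hφ k) (hφ k')]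
          -- The adversary chooses `k'`, so acceptance of the right state is needed for every key
          -- and not only on average.
          exact mul_le_mul_of_nonneg_left
            (norm_braket_sq_le_verProb Ver (hφ k) (hφ k') (hver n k'))
            (mul_nonneg (keyProb_nonneg _ _ _) (guessProb_nonneg (hφ k) t A k'))
      _ = 2 * (∑ k, ∑ k', keyProb KeyGen n k * guessProb StateGen t A n k k' *
          verProb Ver n k' (genState StateGen n k)) +
          2 * ν n * ∑ k, keyProb KeyGen n k * ∑ k', guessProb StateGen t A n k k' := by
          simp only [Finset.mul_sum, ← Finset.sum_add_distrib]
          refine Finset.sum_congr rfl fun k _ => Finset.sum_congr rfl fun k' _ => ?_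
          ring
      -- Key probabilities and guess probabilities each sum to one, so averaging leaves the error `2
      -- * ν n` unchanged.
      _ = 2 * (∑ k, ∑ k', keyProb KeyGen n k * guessProb StateGen t A n k k' *
          verProb Ver n k' (genState StateGen n k)) + 2 * ν n := by
          simp only [sum_guessProb (hφ _), mul_one, sum_keyProb]
      _ ≤ 2 * μ n + 2 * ν n := by linarith [hsec n]

theorem IsOWSG.isPureOWSG {KeyGen : ∀ n, QCircuit 0 (κ n)}
    (hOWSG : IsOWSG KeyGen StateGen fun n => (StateGen n).projVer)
    (hpure : ∀ n k, ∃ ψ, IsPureStateOf (genState StateGen n k) ψ)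
    (hkey : ∀ n k, keyProb KeyGen n k = 1 / 2 ^ κ n) : IsPureOWSG StateGen := by
  choose φ hφ using hpure
  refine ⟨hOWSG.stateGen_qpt, φ, hφ, fun t A hA => ?_⟩
  obtain ⟨ν, hν, h⟩ := hOWSG.secure t A hA
  refine ⟨ν, hν, fun n => ?_⟩
  have := h n
  simp only [hkey, verProb_projVer_genState (hφ n _) (hφ n _)] at this
  exact this

end Schemes

end QCrypto

theorem mainTheorem11 (κ m : ℕ → ℕ)
    (KeyGen : ∀ n, QCircuit 0 (κ n))
    (StateGen : ∀ n, QCircuit (κ n) (m n))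
    (Ver : ∀ n, QCircuit (κ n + m n) 1)
    (hOWSG : IsOWSG KeyGen StateGen Ver)
    (hpure : ∀ n k, ∃ ψ, IsPureStateOf (genState StateGen n k) ψ)
    (hver : ∃ ν, Negligible ν ∧ ∀ n k, 1 - ν n ≤ verProb Ver n k (genState StateGen n k)) :
    ∃ Ver' : ∀ n, QCircuit (κ n + m n) 1,
      IsProjectionVer StateGen Ver' ∧
      IsOWSG KeyGen StateGen Ver' ∧
      ((∀ n k, keyProb KeyGen n k = 1 / 2 ^ κ n) → IsPureOWSG StateGen) :=
  have h := hOWSG.projVer hpure hver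
  ⟨fun n => (StateGen n).projVer, isProjectionVer_projVer, h, h.isPureOWSG hpure⟩
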